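/- **Setting.** $\mathbb N=\{1,2,\dots\}$, $\mathbb N_0=\mathbb N\cup\{0\}$; $n,d\in\mathbb N$; $|\cdot|$ is the Euclidean norm of a vector and the induced 2-norm of a matrix, $|\cdot|_F$ the Frobenius norm, $B_r(0)$ the closed ball of radius $r$. Let $\mathbb X,\mathbb W\subseteq\mathbb R^n$, $\mathbb U\subseteq\mathbb R^m$, $\mathbb S\subseteq\mathbb R^q$, let $f:\mathbb X\times\mathbb U\to\mathbb R^n$, $\psi:\mathbb X\times\mathbb U\to\mathbb R^d$, $\alpha:\mathbb X\times\mathbb S\times\mathbb R^{d\times n}\to\mathbb U$, let $\theta_*,\vartheta_0\in\mathbb R^{d\times n}$, $\gamma>0$, and suppose $g(x,u,w):=f(x,u)+\theta_*^\top\psi(x,u)+w\in\mathbb X$ for all $(x,u,w)\in\mathbb X\times\mathbb U\times\mathbb W$. Given random sequences $(W(t))_{t\in\mathbb N}$ in $\mathbb W$ and $(S(t))_{t\in\mathbb N_0}$ in $\mathbb S$, and $x_0\in\mathbb X$, define for $t\in\mathbb N_0$ $$X(0)=x_0,\quad X(t+1)=g(X(t),U(t),W(t+1)),\quad U(t)=\alpha(X(t),S(t),\hat\theta(t-1)),$$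 where $\hat\theta(-1)=\hat\theta(0)=\vartheta_0$ and, for $t\in\mathbb N$, with $Z(s)=\psi(X(s-1),U(s-1))$, $$\hat\theta(t)=\arg\min_{\theta\in\mathbb R^{d\times n}}\ \sum_{s=1}^t\big|X(s)-\theta^\top Z(s)-f(X(s-1),U(s-1))\big|^2+\gamma|\theta|_F^2 .$$ Write $\phi(t,\xi,u,w)$ for the solution at time $t$ of $x(t+1)=g(x(t),u(t),w(t+1))$, $x(0)=\xi$. A function $h:\mathbb R_{\ge0}\to\mathbb R_{\ge0}$ is in $\mathcal K_\infty$ if it is continuous, strictly increasing and unbounded with $h(0)=0$; it is in $\mathcal K_\infty^{k\text{-SE}}$ if moreover $\ln h(r^k)=o(r)$ as $r\to\infty$. **Assumptions.** 1. $f,\psi,\alpha$ are Borel measurable. 2. $(W(t))_{t\in\mathbb N}$ is i.i.d. with law $\mu_w$, $(S(t))_{t\in\mathbb N_0}$ is i.i.d. with law $\mu_s$, the two sequences are independent, and for some $\sigma_w\ge0$, $\mathbb E\exp(\lambda\zeta^\top W(t))\le\exp(\lambda^2\sigma_w^2/2)$ for all $t\in\mathbb N$, $\lambda\in\mathbb R$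 and unit vectors $\zeta\in\mathbb R^n$. 3. There are $\chi_1,\chi_3,\sigma_2\in\mathcal K_\infty^{1\text{-SE}}$, $\chi_4\in\mathcal K_\infty^{2\text{-SE}}$, $\chi_2,\sigma_1\in\mathcal K_\infty$ and $c_1\ge0$ with $$|\phi(t,\xi,u,w)|\le\chi_1(t)+\chi_2(|\xi|)+\chi_3\Big(\sum_{i=0}^{t-1}\sigma_1(|u(i)|)\Big)+\chi_4\Big(\sum_{i=1}^t\sigma_2(|w(i)|)\Big)+c_1$$ for all $t\in\mathbb N$, $\xi\in\mathbb X$ and all sequences $u$ in $\mathbb U$ and $w$ in $\mathbb W$. 4. There is $u_{\max}\ge0$ with $|\alpha(x,s,\vartheta)|\le u_{\max}$ for all $x\in\mathbb X,s\in\mathbb S,\vartheta\in\mathbb R^{d\times n}$. 5. There is a non-decreasing $\chi_5:\mathbb R_{\ge0}\to\mathbb R_{\ge0}$ with $\chi_5(r)=O(r^k)$ for some $k\in\mathbb N$ and $|\psi(x,u)|\le\chi_5\big(\sqrt{|x|^2+|u|^2}\big)$ for all $x\in\mathbb X$, $u\in\mathbb U$. 6. There are $\mathcal X_{\rm PE}\subseteq\mathbb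 X$ and $c_{\rm PE},p_{\rm PE}>0$ such that for all $\vartheta\in\mathbb R^{d\times n}$, $x\in\mathcal X_{\rm PE}$ and unit vectors $\zeta\in\mathbb R^d$, for $(W,S)\sim\mu_w\times\mu_s$, the probability that $x+W\in\mathbb X$ and $|\zeta^\top\psi(x+W,\alpha(x+W,S,\vartheta))|^2\ge c_{\rm PE}$ is at least $p_{\rm PE}$. **Bounds.** Put $\overline w(0,\delta)=0$, $\overline w(t,\delta)=\sigma_w\sqrt{2n\ln\frac{n\pi^2t^2}{3\delta}}$ for $t\in\mathbb N$, and $$\overline x(t,\delta,x_0)=\chi_1(t)+\chi_2(|x_0|)+\chi_3(t\,\sigma_1(u_{\max}))+\chi_4(t\,\sigma_2(\overline w(t,\delta)))+c_1,$$ $$\overline z(t,\delta,x_0)=\chi_5\Big(\sqrt{\overline x(t-1,\delta,x_0)^2+u_{\max}^2}\Big),\qquad \beta_{\max}(t,\delta,x_0)=\sum_{i=1}^t\overline z^2(i,\delta,x_0)+\gamma,$$ $\Gamma(\mathcal X)=\{f(x,u)+\theta_*^\top\psi(x,u)\mid x\in\mathcal X,\ u\in\mathbb U,\ |u|\le u_{\max}\}$,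 $$T_{\rm excited}(\delta,x_0)=\sup\{T\in\mathbb N\mid\Gamma(B_{\overline x(T-1,\delta/3,x_0)}(0)\cap\mathbb X)\subseteq\mathcal X_{\rm PE}\}\in\mathbb N_0\cup\{\infty\}\quad(\sup\emptyset=0),$$ and let $T_{\rm burn\text{-}in}(\delta,x_0)\in\mathbb N\cup\{\infty\}$ be the infimum ($\inf\emptyset=\infty$) of all $T\in\mathbb N$, $T\ge2$, such that for all integers $t\ge T$ $$t\ge\frac{2}{(1-\ln2)p_{\rm PE}}\Big(d\ln\Big(1+\frac{16\sum_{i=1}^t\overline z^2(i,\delta/3,x_0)}{c_{\rm PE}p_{\rm PE}(t-1)}\Big)+\ln\frac{\pi^2(t-T+1)^2}{2\delta}\Big)+1 .$$ For $\lambda>0$ put $$b_\lambda(t)=\frac1{\sqrt\lambda}\Big(\gamma^{1/2}|\theta_*|_F+\sigma_w\sqrt{2n\big(\ln(3n/\delta)+\tfrac d2\ln(\beta_{\max}(t,\delta/3,x_0)\gamma^{-1})\big)}\Big).$$ **Proposition.** Under assumptions 1–6, for all $\delta\in(0,1)$ and all $x_0\in\mathbb X$ with $|x_0|\le\overline x(0,\delta,x_0)=\chi_2(|x_0|)+c_1$: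 if $T_{\rm burn\text{-}in}(\delta,x_0)\le T_{\rm excited}(\delta,x_0)$, then $$\mathbb P\big(|\hat\theta(t)-\theta_*|\le\tilde e(t,\delta,x_0)\ \text{for all }t\in\mathbb N\big)\ge1-\delta,$$ where, with $T_{\rm burn\text{-}in}$ and $T_{\rm excited}$ evaluated at $(\delta,x_0)$, $\tilde e(t,\delta,x_0)=b_\lambda(t)$ with - $\lambda=\gamma$ if $t<T_{\rm burn\text{-}in}$; - $\lambda=\frac{c_{\rm PE}p_{\rm PE}}4(t-1)+\gamma$ if $T_{\rm burn\text{-}in}\le t\le T_{\rm excited}$; - $\lambda=\frac{c_{\rm PE}p_{\rm PE}}4(T_{\rm excited}-1)+\gamma$ if $t>T_{\rm excited}$. -/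

import Mathlib

open MeasureTheory ProbabilityTheory Filter Set Asymptotics
open scoped NNReal ENNReal

noncomputable section

namespace SysId

/-- `ℝⁿ` with the Euclidean norm. -/
abbrev Vec (n : ℕ) := EuclideanSpace ℝ (Fin n)

/-- `ℝ^{d × n}`. -/
abbrev Mat (d n : ℕ) := Matrix (Fin d) (Fin n) ℝ

/-- The Borel σ-algebra of `ℝ^{d × n}`. -/
instance instMeasurableSpaceMat (d n : ℕ) : MeasurableSpace (Mat d n) :=
  inferInstanceAs (MeasurableSpace (Fin d → Fin n → ℝ))

instance instBorelSpaceMat (d n : ℕ) : BorelSpace (Mat d n) :=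
  inferInstanceAs (BorelSpace (Fin d → Fin n → ℝ))

/-- The induced 2-norm `|A|` of a matrix. -/
def opNorm {d n : ℕ} (A : Mat d n) : ℝ :=
  ‖LinearMap.toContinuousLinearMap (Matrix.toEuclideanLin A)‖

/-- The Frobenius norm `|A|_F` of a matrix. -/
def frobNorm {d n : ℕ} (A : Mat d n) : ℝ :=
  √(∑ i, ∑ j, A i j ^ 2)

/-- The product `θᵀ z`, for `θ ∈ ℝ^{d × n}` and `z ∈ ℝ^d`. -/
def tmul {d n : ℕ} (θ : Mat d n) (z : Vec d) : Vec n :=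
  Matrix.toEuclideanLin θ.transpose z

/-! ### Comparison functions -/

/-- Class `𝒦`. -/
def IsClassK (h : ℝ≥0 → ℝ≥0) : Prop :=
  Continuous h ∧ StrictMono h ∧ h 0 = 0

/-- Class `𝒦_∞`. -/
def IsClassKInf (h : ℝ≥0 → ℝ≥0) : Prop :=
  IsClassK h ∧ Tendsto h atTop atTop

/-- `k`-order sub-exponential: `ln (h (r ^ k)) = o(r)` as `r → ∞`. -/
def IsSubExp (k : ℕ) (h : ℝ≥0 → ℝ≥0) : Prop :=
  (fun r : ℝ≥0 => Real.log (h (r ^ k))) =o[atTop] (fun r : ℝ≥0 => (r : ℝ))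

/-- Asymptotically polynomially bounded: `h (r) = O(r ^ k)` for some `k`, as `r → ∞`. -/
def IsAPB (h : ℝ≥0 → ℝ≥0) : Prop :=
  ∃ k : ℕ, (fun r : ℝ≥0 => (h r : ℝ)) =O[atTop] (fun r : ℝ≥0 => (r : ℝ) ^ k)

/-! ### The system, the controller and the estimator -/

/-- The deterministic data of the closed loop. -/
structure ClosedLoop (n m d q : ℕ) where
  /-- The state space. -/
  stateSpace : Set (Vec n)
  /-- The control space. -/
  controlSpace : Set (Vec m)
  /-- The set in which the process noise takes its values. -/
  procSpace : Set (Vec n)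
  /-- The set in which the exploratory noise takes its values. -/
  explSpace : Set (Vec q)
  /-- The nominal model. -/
  f : stateSpace × controlSpace → Vec n
  /-- The basis functions. -/
  ψ : stateSpace × controlSpace → Vec d
  /-- The control policy. -/
  α : stateSpace × explSpace × Mat d n → controlSpace
  /-- The true parameter. -/
  θs : Mat d n
  /-- The regularisation parameter. -/
  γ : ℝ
  /-- The initial parameter estimate. -/
  ϑ0 : Mat d n
  γ_pos : 0 < γ
  /-- The map `g (x, u, w) = f (x, u) + θ_*ᵀ ψ (x, u) + w` has codomain the state space. -/
  g_mem : ∀ (x : stateSpace) (u : controlSpace) (w : procSpace),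
    f (x, u) + tmul θs (ψ (x, u)) + (w : Vec n) ∈ stateSpace

namespace ClosedLoop

variable {n m d q : ℕ} (L : ClosedLoop n m d q)

/-- `g (x, u, 0)`, a vector that need not lie in the state space. -/
def pred (x : L.stateSpace) (u : L.controlSpace) : Vec n :=
  L.f (x, u) + tmul L.θs (L.ψ (x, u))

/-- `g : 𝕏 × 𝕌 × 𝕎 → 𝕏`. -/
def g (x : L.stateSpace) (u : L.controlSpace) (w : L.procSpace) : L.stateSpace :=
  ⟨L.f (x, u) + tmul L.θs (L.ψ (x, u)) + (w : Vec n), L.g_mem x u w⟩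

/-- The deterministic solution `φ (t, ξ, u, w)`, which depends on `u 0, …, u (t - 1)` and
`w 1, …, w t` only. -/
def φ (ξ : L.stateSpace) (u : ℕ → L.controlSpace) (w : ℕ → L.procSpace) : ℕ → L.stateSpace
  | 0 => ξ
  | t + 1 => L.g (φ ξ u w t) (u t) (w (t + 1))

/-- The regularised least squares cost of `θ`, given `(X (s), U (s))` for `s ≤ t`:
`∑_{s=1}^t |X (s) - θᵀ Z (s) - f (X (s-1), U (s-1))|² + γ |θ|_F²` with
`Z (s) = ψ (X (s-1), U (s-1))`. -/
def rlsCost (t : ℕ) (h : Fin (t + 1) → L.stateSpace × L.controlSpace) (θ : Mat d n) : ℝ :=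
  ∑ s : Fin t, ‖((h s.succ).1 : Vec n) - tmul θ (L.ψ (h s.castSucc)) - L.f (h s.castSucc)‖ ^ 2
    + L.γ * frobNorm θ ^ 2

/-- The estimate `θ̂ (t)`: the initial estimate for `t = 0`, and the minimiser of the regularised
least squares cost for `t ≥ 1`. -/
def rls (t : ℕ) (h : Fin (t + 1) → L.stateSpace × L.controlSpace) : Mat d n :=
  if t = 0 then L.ϑ0 else Classical.epsilon fun θ => ∀ θ', L.rlsCost t h θ ≤ L.rlsCost t h θ'

/-- The closed-loop pair `(X (t), U (t))` for given noise realisations `w 1, w 2, …` and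
`s 0, s 1, …` (the value `w 0` is not used). Both `θ̂ (-1)` and `θ̂ (0)` are the initial
estimate. -/
def traj (x0 : L.stateSpace) (w : ℕ → L.procSpace) (s : ℕ → L.explSpace) :
    ℕ → L.stateSpace × L.controlSpace
  | 0 => (x0, L.α (x0, s 0, L.ϑ0))
  | t + 1 =>
    let past : Fin (t + 1) → L.stateSpace × L.controlSpace := fun i => traj x0 w s i.1
    let x := L.g (past (Fin.last t)).1 (past (Fin.last t)).2 (w (t + 1))
    (x, L.α (x, s (t + 1), L.rls t past))
termination_by t => t
decreasing_by exact i.2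

/-- The estimate `θ̂ (t)`, `t ≥ 0`, along the closed loop. -/
def estimate (x0 : L.stateSpace) (w : ℕ → L.procSpace) (s : ℕ → L.explSpace) (t : ℕ) : Mat d n :=
  L.rls t fun i => L.traj x0 w s i.1

/-- The closed-loop recursion: `X (t+1) = g (X (t), U (t), W (t+1))` and
`U (t+1) = α (X (t+1), S (t+1), θ̂ (t))`. -/
theorem traj_succ (x0 : L.stateSpace) (w : ℕ → L.procSpace) (s : ℕ → L.explSpace) (t : ℕ) :
    L.traj x0 w s (t + 1) =
      (L.g (L.traj x0 w s t).1 (L.traj x0 w s t).2 (w (t + 1)),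
        L.α (L.g (L.traj x0 w s t).1 (L.traj x0 w s t).2 (w (t + 1)), s (t + 1),
          L.estimate x0 w s t)) := by
  rw [ClosedLoop.traj]
  rfl

/-- The regularised least squares cost has a minimiser. -/
theorem exists_rls_minimiser (t : ℕ) (h : Fin (t + 1) → L.stateSpace × L.controlSpace) :
    ∃ θ, ∀ θ', L.rlsCost t h θ ≤ L.rlsCost t h θ' := by
  have hfrob : ∀ θ : Mat d n, frobNorm θ ^ 2 = ∑ i, ∑ j, θ i j ^ 2 := fun θ =>
    Real.sq_sqrt (Finset.sum_nonneg fun i _ => Finset.sum_nonneg fun j _ => sq_nonneg _)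
  have hcont : Continuous fun θ : Mat d n => L.rlsCost t h θ := by
    have hc : ∀ z : Vec d, Continuous fun θ : Mat d n => tmul θ z := by
      intro z
      have : Continuous fun θ : Mat d n => WithLp.toLp 2 (θ.transpose.mulVec z.ofLp) := by
        fun_prop
      exact this
    have hf : Continuous fun θ : Mat d n => frobNorm θ ^ 2 := by
      simp only [hfrob]
      fun_prop
    unfold rlsCost
    refine Continuous.add (continuous_finsetSum _ fun s _ => ?_) (continuous_const.mul hf)
    exact (((continuous_const.sub (hc _)).sub continuous_const).norm).pow 2
  let C : ℝ := L.rlsCost t h 0 / L.γ + 1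
  refine hcont.exists_forall_le' (0 : Mat d n) ?_
  have hK : IsCompact (Set.univ.pi fun _ : Fin d => Set.univ.pi fun _ : Fin n => Set.Icc (-C) C) :=
    isCompact_univ_pi fun _ => isCompact_univ_pi fun _ => isCompact_Icc
  refine Filter.mem_of_superset hK.compl_mem_cocompact ?_
  intro θ hθ
  by_contra hlt
  apply hθ
  simp only [Set.mem_ofPred_eq, not_le] at hlt
  intro i _ j _
  have h1 : θ i j ^ 2 ≤ frobNorm θ ^ 2 := by
    rw [hfrob]
    refine le_trans ?_ (Finset.single_le_sum (f := fun i => ∑ j, θ i j ^ 2)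
      (fun i _ => Finset.sum_nonneg fun j _ => sq_nonneg _) (Finset.mem_univ i))
    exact Finset.single_le_sum (f := fun j => θ i j ^ 2) (fun j _ => sq_nonneg _)
      (Finset.mem_univ j)
  have h2 : L.γ * frobNorm θ ^ 2 ≤ L.rlsCost t h θ :=
    le_add_of_nonneg_left (Finset.sum_nonneg fun s _ => sq_nonneg _)
  have hγ := L.γ_pos
  have h3 : θ i j ^ 2 ≤ L.rlsCost t h 0 / L.γ := by
    rw [le_div_iff₀ hγ]
    nlinarith
  have h4 : 0 ≤ L.rlsCost t h 0 / L.γ := (sq_nonneg _).trans h3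
  have h5 : θ i j ^ 2 ≤ C ^ 2 := by
    change _ ≤ (L.rlsCost t h 0 / L.γ + 1) ^ 2
    nlinarith
  exact abs_le.mp (abs_le_of_sq_le_sq h5 (by change 0 ≤ L.rlsCost t h 0 / L.γ + 1; linarith))

/-- The estimate minimises the cost at every `t ≥ 1`. -/
theorem rls_isMin (t : ℕ) (ht : t ≠ 0) (h : Fin (t + 1) → L.stateSpace × L.controlSpace)
    (θ : Mat d n) : L.rlsCost t h (L.rls t h) ≤ L.rlsCost t h θ := by
  rw [rls, if_neg ht]
  exact Classical.epsilon_spec (L.exists_rls_minimiser t h) θ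

/-! ### Assumptions -/

/-- The system maps are Borel measurable. -/
def MeasurableMaps : Prop :=
  Measurable L.f ∧ Measurable L.ψ ∧ Measurable L.α

/-- Assumptions on the noise: `W 1, W 2, …` are i.i.d. with law `μw`, `S 0, S 1, …` are i.i.d. with
law `μs`, the two sequences are independent, and each `W t`, `t ≥ 1`, is `σw²`-sub-Gaussian:
`𝔼 exp (λ ζᵀ W t) ≤ exp (λ² σw² / 2)` for all real `λ` and unit vectors `ζ` (this implies that
`W t` has zero mean). The variable `W 0` is not used. -/
structure NoiseAssumption {Ω : Type*} [MeasurableSpace Ω] (P : Measure Ω)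
    (W : ℕ → Ω → L.procSpace) (S : ℕ → Ω → L.explSpace)
    (μw : Measure L.procSpace) (μs : Measure L.explSpace) (σw : ℝ≥0) : Prop where
  measurable_W : ∀ t, 1 ≤ t → Measurable (W t)
  measurable_S : ∀ t, Measurable (S t)
  law_W : ∀ t, 1 ≤ t → P.map (W t) = μw
  law_S : ∀ t, P.map (S t) = μs
  indep_W : iIndepFun (fun t => W (t + 1)) P
  indep_S : iIndepFun S P
  indep_W_S : IndepFun (fun ω t => W (t + 1) ω) (fun ω t => S t ω) P
  subGaussian_W : ∀ t, 1 ≤ t → ∀ ζ : Vec n, ‖ζ‖ = 1 →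
    HasSubgaussianMGF (fun ω => inner ℝ ζ (W t ω : Vec n)) (σw ^ 2) P

end ClosedLoop

/-- The functions and constants that occur in the growth assumptions. -/
structure Growth where
  /-- Growth in time. -/
  χ₁ : ℝ≥0 → ℝ≥0
  /-- Growth in the initial state. -/
  χ₂ : ℝ≥0 → ℝ≥0
  /-- Growth in the control energy. -/
  χ₃ : ℝ≥0 → ℝ≥0
  /-- Growth in the noise energy. -/
  χ₄ : ℝ≥0 → ℝ≥0
  /-- Growth of the basis functions. -/
  χ₅ : ℝ≥0 → ℝ≥0
  /-- Control energy. -/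
  σ₁ : ℝ≥0 → ℝ≥0
  /-- Noise energy. -/
  σ₂ : ℝ≥0 → ℝ≥0
  /-- Offset. -/
  c₁ : ℝ≥0
  /-- Bound on the controls. -/
  umax : ℝ≥0

namespace ClosedLoop

variable {n m d q : ℕ} (L : ClosedLoop n m d q) (B : Growth)

/-- Sub-exponential input-to-state bound on the reachable states. -/
structure StateBound : Prop where
  χ₁_mem : IsClassKInf B.χ₁ ∧ IsSubExp 1 B.χ₁
  χ₂_mem : IsClassKInf B.χ₂
  χ₃_mem : IsClassKInf B.χ₃ ∧ IsSubExp 1 B.χ₃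
  χ₄_mem : IsClassKInf B.χ₄ ∧ IsSubExp 2 B.χ₄
  σ₁_mem : IsClassKInf B.σ₁
  σ₂_mem : IsClassKInf B.σ₂ ∧ IsSubExp 1 B.σ₂
  bound : ∀ t : ℕ, 1 ≤ t → ∀ (ξ : L.stateSpace) (u : ℕ → L.controlSpace) (w : ℕ → L.procSpace),
    ‖(L.φ ξ u w t : Vec n)‖₊ ≤ B.χ₁ t + B.χ₂ ‖(ξ : Vec n)‖₊
      + B.χ₃ (∑ i ∈ Finset.range t, B.σ₁ ‖(u i : Vec m)‖₊)
      + B.χ₄ (∑ i ∈ Finset.Icc 1 t, B.σ₂ ‖(w i : Vec n)‖₊) + B.c₁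

/-- The policy is bounded by `umax`. -/
def ControlBound : Prop :=
  ∀ (x : L.stateSpace) (s : L.explSpace) (ϑ : Mat d n), ‖(L.α (x, s, ϑ) : Vec m)‖₊ ≤ B.umax

/-- The basis functions are bounded by a non-decreasing asymptotically polynomially bounded
function of the Euclidean norm of `(x, u)`. -/
structure BasisBound : Prop where
  apb : IsAPB B.χ₅
  mono : Monotone B.χ₅
  bound : ∀ (x : L.stateSpace) (u : L.controlSpace),
    ‖L.ψ (x, u)‖₊ ≤ B.χ₅ (NNReal.sqrt (‖(x : Vec n)‖₊ ^ 2 + ‖(u : Vec m)‖₊ ^ 2))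

/-- Regional excitation: for all `ϑ`, all `x ∈ 𝒳` and all unit vectors `ζ`, the probability under
`(W, S) ∼ μw × μs` that `|ζᵀ ψ (x + W, α (x + W, S, ϑ))|² ≥ c` is at least `p`. As `ψ` and `α` are
defined on the state space only, `x + W` lying there is part of the event. -/
def RegionallyExcited (μw : Measure L.procSpace) (μs : Measure L.explSpace)
    (𝒳 : Set (Vec n)) (c p : ℝ) : Prop :=
  ∀ (ϑ : Mat d n), ∀ x ∈ 𝒳, ∀ ζ : Vec d, ‖ζ‖ = 1 →
    p ≤ (μw.prod μs).real {ws | ∃ hx : x + (ws.1 : Vec n) ∈ L.stateSpace,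
      c ≤ |inner ℝ ζ (L.ψ (⟨x + (ws.1 : Vec n), hx⟩,
        L.α (⟨x + (ws.1 : Vec n), hx⟩, ws.2, ϑ)))| ^ 2}

/-! ### The bounds -/

/-- The process noise bound `w̄ (t, δ)` in dimension `n`. -/
def wBar (n : ℕ) (σw : ℝ≥0) (t : ℕ) (δ : ℝ) : ℝ≥0 :=
  if t = 0 then 0
  else σw * Real.toNNReal √(2 * n * Real.log (n * Real.pi ^ 2 * (t : ℝ) ^ 2 / (3 * δ)))

/-- The state bound `x̄ (t, δ, x₀)`. -/
def xBar (σw : ℝ≥0) (t : ℕ) (δ : ℝ) (x0 : L.stateSpace) : ℝ≥0 :=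
  B.χ₁ t + B.χ₂ ‖(x0 : Vec n)‖₊ + B.χ₃ (t * B.σ₁ B.umax)
    + B.χ₄ (t * B.σ₂ (wBar n σw t δ)) + B.c₁

/-- The regressor bound `z̄ (t, δ, x₀)`, `t ≥ 1`. -/
def zBar (σw : ℝ≥0) (t : ℕ) (δ : ℝ) (x0 : L.stateSpace) : ℝ≥0 :=
  B.χ₅ (NNReal.sqrt (L.xBar B σw (t - 1) δ x0 ^ 2 + B.umax ^ 2))

/-- `∑_{i=1}^t z̄² (i, δ, x₀)`. -/
def zBarSum (σw : ℝ≥0) (t : ℕ) (δ : ℝ) (x0 : L.stateSpace) : ℝ :=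
  ∑ i ∈ Finset.Icc 1 t, (L.zBar B σw i δ x0 : ℝ) ^ 2

/-- The Gramian upper bound `β_max (t, δ, x₀)`. -/
def βmax (σw : ℝ≥0) (t : ℕ) (δ : ℝ) (x0 : L.stateSpace) : ℝ :=
  L.zBarSum B σw t δ x0 + L.γ

/-- The one-step predicted reachable set `Γ (𝒳)`. -/
def reach (𝒳 : Set (Vec n)) : Set (Vec n) :=
  {y | ∃ (x : L.stateSpace) (u : L.controlSpace),
    (x : Vec n) ∈ 𝒳 ∧ ‖(u : Vec m)‖₊ ≤ B.umax ∧ y = L.pred x u}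

/-- The excited time bound, a supremum in `ℕ ∪ {∞}` (zero if no `T ≥ 1` is admissible). -/
def Texcited (σw : ℝ≥0) (XPE : Set (Vec n)) (δ : ℝ) (x0 : L.stateSpace) : ℕ∞ :=
  sSup {τ | ∃ T : ℕ, τ = T ∧ 1 ≤ T ∧
    L.reach B (Metric.closedBall 0 (L.xBar B σw (T - 1) (δ / 3) x0) ∩ L.stateSpace) ⊆ XPE}

/-- The burn-in time bound, an infimum in `ℕ ∪ {∞}`. No `T = 1` is admissible. -/
def Tburnin (σw : ℝ≥0) (c p δ : ℝ) (x0 : L.stateSpace) : ℕ∞ :=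
  sInf {τ | ∃ T : ℕ, τ = T ∧ 1 ≤ T ∧ ∀ t : ℕ, T ≤ t →
    2 / ((1 - Real.log 2) * p) *
        (d * Real.log (1 + 16 * L.zBarSum B σw t (δ / 3) x0 / (c * p * ((t : ℝ) - 1)))
          + Real.log (Real.pi ^ 2 * ((t : ℝ) - T + 1) ^ 2 / (2 * δ))) + 1 ≤ (t : ℝ)}

/-- The data-independent error bound that results from a lower bound `lam` on `λ_min (G (t))`. -/
def errBound (σw : ℝ≥0) (lam : ℝ) (t : ℕ) (δ : ℝ) (x0 : L.stateSpace) : ℝ :=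
  1 / √lam * (√L.γ * frobNorm L.θs
    + σw * √(2 * n * (Real.log (3 * n / δ)
        + (d : ℝ) / 2 * Real.log (L.βmax B σw t (δ / 3) x0 * L.γ⁻¹))))

/-- The error bound `e (t, δ, x₀)`. -/
def err (σw : ℝ≥0) (c p : ℝ) (t : ℕ) (δ : ℝ) (x0 : L.stateSpace) : ℝ :=
  L.errBound B σw (c * p / 4 * ((t : ℝ) - 1) + L.γ) t δ x0

/-- The extended error bound `ẽ (t, δ, x₀)`: before the burn-in time, on the interval between the
burn-in time and the excited time, and after the excited time (which is then finite). -/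
def errExt (σw : ℝ≥0) (XPE : Set (Vec n)) (c p : ℝ) (t : ℕ) (δ : ℝ) (x0 : L.stateSpace) : ℝ :=
  if (t : ℕ∞) < L.Tburnin B σw c p δ x0 then
    L.errBound B σw L.γ t δ x0
  else if (t : ℕ∞) ≤ L.Texcited B σw XPE δ x0 then
    L.err B σw c p t δ x0
  else
    L.errBound B σw (c * p / 4 * (((L.Texcited B σw XPE δ x0).toNat : ℝ) - 1) + L.γ) t δ x0

end ClosedLoop

end SysId

end

/-! By the normal equations, the error Δ = θ̂(t) - θ_* solves G Δ = ∑ z_s w_{s+1}ᵀ - γ θ_*, where G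
= γ I + ∑ z_s z_sᵀ. Testing this against u = Δ v and applying Cauchy–Schwarz in the G-inner product
bounds |Δ| by λ^(-1/2) times a bias √γ |θ_*|_F plus the size of the noise term in the G⁻¹-norm, for
any λ below the spectrum of G (`opNorm_le_of_gram_mul_eq`). It remains to control three things at
all times at once, each up to probability δ/3.

States: sub-Gaussian tails and a union bound keep every |W(t)| below w̄, and the growth assumption
then keeps the states below x̄ (`measure_exists_wBar_lt_le`, `nnnorm_traj_fst_le`). This also bounds
det G.

Noise: √(γ^d / det G) exp(Sᵀ G⁻¹ S / (2c)) is a nonnegative supermartingale, with S the cross term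
of one noise coordinate, so Ville's inequality bounds Sᵀ G⁻¹ S uniformly in time
(`measure_exists_lt_quad_le`).

Excitation: as long as the one-step prediction lies in the excited region, each fixed direction is
excited at the next step with conditional probability at least p. A Chernoff bound for dependent
trials counts the excitations (`measure_card_lt_le`), and a net of the sphere makes the count
uniform in the direction (`measure_exists_sum_lt_le`). The burn-in inequality is what makes the
failure probabilities summable to δ/3. Conditioning on the noise bound would destroy independence of
past and future noise; the count is therefore restricted to the adapted, decreasing events
`boundedStates`.

After the excited time nothing new is needed: the Gramian is nondecreasing, so the last lower bound
persists. -/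

noncomputable section

namespace SysId

/-! ### Independence, Ville's inequality and a Chernoff bound for dependent trials. -/

section Probability

variable {Ω : Type*}

/-- If `m₁ ⟂ m₁'`, `m₂ ⟂ m₂'` and `m₁ ⊔ m₁' ⟂ m₂ ⊔ m₂'`, then `m₁ ⊔ m₂ ⟂ m₁' ⊔ m₂'`. -/
theorem indep_sup_sup {m₁ m₁' m₂ m₂' : MeasurableSpace Ω} {mΩ : MeasurableSpace Ω}
    {P : Measure Ω} [IsProbabilityMeasure P]
    (h₁ : m₁ ≤ mΩ) (h₁' : m₁' ≤ mΩ) (h₂ : m₂ ≤ mΩ) (h₂' : m₂' ≤ mΩ)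
    (hA : Indep m₁ m₁' P) (hB : Indep m₂ m₂' P) (hAB : Indep (m₁ ⊔ m₁') (m₂ ⊔ m₂') P) :
    Indep (m₁ ⊔ m₂) (m₁' ⊔ m₂') P := by
  have key : ∀ a b : MeasurableSpace Ω, a ⊔ b = MeasurableSpace.generateFrom
      {s | ∃ u v, MeasurableSet[a] u ∧ MeasurableSet[b] v ∧ s = u ∩ v} := by
    intro a b
    apply le_antisymm
    · refine sup_le (fun s hs => ?_) (fun s hs => ?_)
      · exact MeasurableSpace.measurableSet_generateFrom
          ⟨s, univ, hs, MeasurableSet.univ, (inter_univ s).symm⟩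
      · exact MeasurableSpace.measurableSet_generateFrom
          ⟨univ, s, MeasurableSet.univ, hs, (univ_inter s).symm⟩
    · refine MeasurableSpace.generateFrom_le ?_
      rintro _ ⟨u, v, hu, hv, rfl⟩
      exact MeasurableSet.inter ((le_sup_left : a ≤ a ⊔ b) u hu) ((le_sup_right : b ≤ a ⊔ b) v hv)
  have hpi : ∀ a b : MeasurableSpace Ω, IsPiSystem
      {s | ∃ u v, MeasurableSet[a] u ∧ MeasurableSet[b] v ∧ s = u ∩ v} := by
    rintro a b _ ⟨u, v, hu, hv, rfl⟩ _ ⟨u', v', hu', hv', rfl⟩ -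
    exact ⟨u ∩ u', v ∩ v', MeasurableSet.inter hu hu', MeasurableSet.inter hv hv',
      inter_inter_inter_comm u v u' v'⟩
  refine IndepSets.indep (sup_le h₁ h₂) (sup_le h₁' h₂') (hpi m₁ m₂) (hpi m₁' m₂')
    (key m₁ m₂) (key m₁' m₂') ?_
  rw [IndepSets_iff]
  rintro _ _ ⟨a, b, ha, hb, rfl⟩ ⟨a', b', ha', hb', rfl⟩
  rw [Indep_iff] at hA hB hAB
  have l₁ : m₁ ≤ m₁ ⊔ m₁' := le_sup_left
  have l₁' : m₁' ≤ m₁ ⊔ m₁' := le_sup_right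
  have l₂ : m₂ ≤ m₂ ⊔ m₂' := le_sup_left
  have l₂' : m₂' ≤ m₂ ⊔ m₂' := le_sup_right
  -- Regrouping by sequence instead of by past and future turns both sides into the product of the
  -- same four probabilities.
  rw [inter_inter_inter_comm, hAB _ _ ((l₁ _ ha).inter (l₁' _ ha')) ((l₂ _ hb).inter (l₂' _ hb')),
    hA _ _ ha ha', hB _ _ hb hb', hAB _ _ (l₁ _ ha) (l₂ _ hb), hAB _ _ (l₁' _ ha') (l₂' _ hb')]
  ring

/-- Freezing lemma: an independent variable may be integrated first. -/
theorem lintegral_mul_comp_of_indep {ℱ : MeasurableSpace Ω} {mΩ : MeasurableSpace Ω}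
    {P : Measure Ω} [IsProbabilityMeasure P] (hℱ : ℱ ≤ mΩ)
    {α β : Type*} [MeasurableSpace α] [MeasurableSpace β] {Y : Ω → β} (hY : Measurable Y)
    (hind : Indep ℱ (MeasurableSpace.comap Y inferInstance) P)
    {H : Ω → α} (hH : Measurable[ℱ] H) {f : Ω → ℝ≥0∞} (hf : Measurable[ℱ] f)
    {F : α × β → ℝ≥0∞} (hF : Measurable F) :
    ∫⁻ ω, f ω * F (H ω, Y ω) ∂P = ∫⁻ ω, f ω * ∫⁻ y, F (H ω, y) ∂(P.map Y) ∂P := by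
  have hH' : Measurable H := hH.mono hℱ le_rfl
  have hf' : Measurable f := hf.mono hℱ le_rfl
  -- Pairing `f` with `H` lets a single independence statement, and hence one use of Tonelli, cover
  -- the weight as well.
  have hpair : Measurable[ℱ] fun ω => (f ω, H ω) := hf.prodMk hH
  have hI : IndepFun (fun ω => (f ω, H ω)) Y P := by
    rw [IndepFun_iff_Indep]
    exact indep_of_indep_of_le_left hind hpair.comap_le
  have hmap := (indepFun_iff_map_prod_eq_prod_map_map (hf'.prodMk hH').aemeasurable
    hY.aemeasurable).1 hI
  have : IsProbabilityMeasure (P.map Y) := Measure.isProbabilityMeasure_map hY.aemeasurable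
  have hG : Measurable fun x : (ℝ≥0∞ × α) × β => x.1.1 * F (x.1.2, x.2) := by fun_prop
  calc ∫⁻ ω, f ω * F (H ω, Y ω) ∂P
      = ∫⁻ x, x.1.1 * F (x.1.2, x.2) ∂(P.map fun ω => ((f ω, H ω), Y ω)) := by
        rw [lintegral_map hG (by fun_prop)]
    _ = ∫⁻ x, ∫⁻ y, x.1 * F (x.2, y) ∂(P.map Y) ∂(P.map fun ω => (f ω, H ω)) := by
        rw [hmap, lintegral_prod _ hG.aemeasurable]
    _ = ∫⁻ x, x.1 * ∫⁻ y, F (x.2, y) ∂(P.map Y) ∂(P.map fun ω => (f ω, H ω)) := by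
        refine lintegral_congr fun x => ?_
        rw [lintegral_const_mul _ (by fun_prop)]
    _ = _ := by
        rw [lintegral_map _ (by fun_prop)]
        exact measurable_fst.mul ((hF.lintegral_prod_right').comp measurable_snd)

/-- Ville's maximal inequality for nonnegative supermartingales. -/
theorem mul_measure_exists_le {mΩ : MeasurableSpace Ω} {P : Measure Ω} (ℱ : Filtration ℕ mΩ)
    {M : ℕ → Ω → ℝ≥0∞} (hM : ∀ t, Measurable[ℱ t] (M t))
    (hstep : ∀ t A, MeasurableSet[ℱ t] A → ∫⁻ ω in A, M (t + 1) ω ∂P ≤ ∫⁻ ω in A, M t ω ∂P)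
    (a : ℝ≥0∞) : a * P {ω | ∃ t, a ≤ M t ω} ≤ ∫⁻ ω, M 0 ω ∂P := by
  -- `C T`: the level `a` has not been reached by time `T`. The inequality `hind` below is optional
  -- stopping at the first hitting time, proved by induction: mass that hits at `T` is moved out of
  -- the integral and is worth at least `a`.
  let C : ℕ → Set Ω := fun T => {ω | ∀ t ≤ T, M t ω < a}
  have hmeas : ∀ s t, s ≤ t → MeasurableSet[ℱ t] {ω | M s ω < a} := fun s t hst =>
    ℱ.mono hst _ (hM s measurableSet_Iio)
  have hC : ∀ T, MeasurableSet[ℱ T] (C T) := by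
    intro T
    have : C T = ⋂ t, ⋂ (_ : t ≤ T), {ω | M t ω < a} := by ext; simp [C]
    rw [this]
    exact MeasurableSet.iInter fun t => MeasurableSet.iInter fun ht => hmeas t T ht
  have hC' : ∀ T, MeasurableSet (C T) := fun T => ℱ.le T _ (hC T)
  have hind : ∀ T, a * P (C T)ᶜ + ∫⁻ ω in C T, M T ω ∂P ≤ ∫⁻ ω, M 0 ω ∂P := by
    have hsplit : ∀ T (B : Set Ω), MeasurableSet B → C T ⊆ B → B \ C T ⊆ {ω | a ≤ M T ω} →
        a * P (B \ C T) + ∫⁻ ω in C T, M T ω ∂P ≤ ∫⁻ ω in B, M T ω ∂P := by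
      intro T B hB hCB hBC
      have h1 : a * P (B \ C T) ≤ ∫⁻ ω in B \ C T, M T ω ∂P := by
        rw [← setLIntegral_const]
        exact setLIntegral_mono' (hB.diff (hC' T)) fun ω hω => hBC hω
      calc _ ≤ ∫⁻ ω in B \ C T, M T ω ∂P + ∫⁻ ω in C T, M T ω ∂P := by gcongr
        _ = ∫⁻ ω in B, M T ω ∂P := by
          rw [← lintegral_union (hC' T) disjoint_sdiff_left, sdiff_union_of_subset hCB]
    intro T
    induction T with
    | zero =>
      have := hsplit 0 univ MeasurableSet.univ (subset_univ _) (by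
        intro ω hω
        by_contra h
        exact hω.2 fun t ht => by
          obtain rfl : t = 0 := by omega
          exact not_le.1 h)
      simpa [compl_eq_univ_sdiff] using this
    | succ T ih =>
      have hsub : C (T + 1) ⊆ C T := fun ω h t ht => h t (by omega)
      have h1 := hsplit (T + 1) (C T) (hC' T) hsub (by
        intro ω hω
        by_contra h
        refine hω.2 fun t ht => ?_
        rcases Nat.lt_or_ge T t with h' | h'
        · obtain rfl : t = T + 1 := by omega
          exact not_le.1 h
        · exact hω.1 t h')
      have h2 : (C (T + 1))ᶜ ⊆ (C T)ᶜ ∪ (C T \ C (T + 1)) := by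
        intro ω hω
        by_cases h : ω ∈ C T
        · exact Or.inr ⟨h, hω⟩
        · exact Or.inl h
      calc a * P (C (T + 1))ᶜ + ∫⁻ ω in C (T + 1), M (T + 1) ω ∂P
          ≤ a * (P (C T)ᶜ + P (C T \ C (T + 1))) + ∫⁻ ω in C (T + 1), M (T + 1) ω ∂P := by
            gcongr
            exact (measure_mono h2).trans (measure_union_le _ _)
        _ = a * P (C T)ᶜ + (a * P (C T \ C (T + 1)) + ∫⁻ ω in C (T + 1), M (T + 1) ω ∂P) := by
            ring
        _ ≤ a * P (C T)ᶜ + ∫⁻ ω in C T, M T ω ∂P := by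
            gcongr
            exact h1.trans (hstep T _ (hC T))
        _ ≤ _ := ih
  have hU : {ω | ∃ t, a ≤ M t ω} = ⋃ T, (C T)ᶜ := by
    ext ω
    simp only [mem_iUnion, mem_compl_iff, mem_ofPred_eq, C, not_forall, not_lt]
    exact ⟨fun ⟨t, ht⟩ => ⟨t, t, le_rfl, ht⟩, fun ⟨_, t, _, ht⟩ => ⟨t, ht⟩⟩
  have hmono : Monotone fun T => (C T)ᶜ := fun S T hST =>
    compl_subset_compl.2 fun ω h t ht => h t (ht.trans hST)
  rw [hU, hmono.measure_iUnion, ENNReal.mul_iSup]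
  exact iSup_le fun T => le_self_add.trans (hind T)

/-- Iterated conditional contraction. -/
theorem lintegral_prod_le_pow {mΩ : MeasurableSpace Ω} {P : Measure Ω} [IsProbabilityMeasure P]
    (ℱ : Filtration ℕ mΩ) {K : ℕ → Ω → ℝ≥0∞} (hK : ∀ i, Measurable[ℱ i] (K i))
    {A : ℕ → Set Ω} (hA : Antitone A) {r : ℝ≥0∞} {m : ℕ}
    (hstep : ∀ i < m, ∀ f : Ω → ℝ≥0∞, Measurable[ℱ i] f →
      ∫⁻ ω in A i, f ω * K (i + 1) ω ∂P ≤ r * ∫⁻ ω in A i, f ω ∂P) :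
    ∫⁻ ω in A m, ∏ i ∈ Finset.range m, K (i + 1) ω ∂P ≤ r ^ m := by
  have hprod : ∀ k, Measurable[ℱ k] fun ω => ∏ i ∈ Finset.range k, K (i + 1) ω := fun k =>
    Finset.measurable_fun_prod _ fun i hi =>
      (hK (i + 1)).mono (ℱ.mono (Nat.succ_le_of_lt (Finset.mem_range.1 hi))) le_rfl
  have : ∀ k ≤ m, ∫⁻ ω in A k, ∏ i ∈ Finset.range k, K (i + 1) ω ∂P ≤ r ^ k := by
    intro k
    induction k with
    | zero => intro _; simpa using prob_le_one
    | succ k ih =>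
      intro hk
      -- The one-step contraction is available on `A k`, so the domain is first enlarged from `A (k
      -- + 1)` to `A k`.
      calc ∫⁻ ω in A (k + 1), ∏ i ∈ Finset.range (k + 1), K (i + 1) ω ∂P
          ≤ ∫⁻ ω in A k, (∏ i ∈ Finset.range k, K (i + 1) ω) * K (k + 1) ω ∂P := by
            simp only [Finset.prod_range_succ]
            exact lintegral_mono_set (hA (Nat.le_succ k))
        _ ≤ r * r ^ k := (hstep k (by omega) _ (hprod k)).trans (by gcongr; exact ih (by omega))
        _ = r ^ (k + 1) := (pow_succ' r k).symm
  exact this m le_rfl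

/-- Chernoff's bound for the lower tail of the number of successes, when each trial succeeds with
conditional probability at least `p` on the event `A i`. -/
theorem measure_card_lt_le {mΩ : MeasurableSpace Ω} {P : Measure Ω} [IsProbabilityMeasure P]
    (ℱ : Filtration ℕ mΩ) {E : ℕ → Set Ω} (hE : ∀ i, MeasurableSet[ℱ i] (E i))
    {A : ℕ → Set Ω} (hA : Antitone A) (hAm : ∀ i, MeasurableSet[ℱ i] (A i)) {p : ℝ} (hp : 0 ≤ p)
    {m : ℕ}
    (hstep : ∀ i < m, ∀ f : Ω → ℝ≥0∞, Measurable[ℱ i] f →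
      ENNReal.ofReal p * ∫⁻ ω in A i, f ω ∂P ≤ ∫⁻ ω in A i, f ω * (E (i + 1)).indicator 1 ω ∂P) :
    P (A m ∩ {ω | ∑ i ∈ Finset.range m, (E (i + 1)).indicator (1 : Ω → ℝ) ω < p * m / 2}) ≤
      ENNReal.ofReal (Real.exp (-((1 - Real.log 2) * p * m / 2))) := by
  classical
  -- This is exp(-log 2 · 1_E), the Chernoff tilt with parameter log 2. Its conditional mean is at
  -- most 1 - p/2 ≤ exp(-p/2).
  let K : ℕ → Ω → ℝ≥0∞ := fun i ω => if ω ∈ E i then 2⁻¹ else 1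
  have hK : ∀ i, Measurable[ℱ i] (K i) := fun i =>
    Measurable.ite (hE i) measurable_const measurable_const
  have hK' : ∀ i, Measurable (K i) := fun i => (hK i).mono (ℱ.le i) le_rfl
  have hE' : ∀ i, MeasurableSet (E i) := fun i => ℱ.le i _ (hE i)
  have hsum : ∀ i ω, K i ω + 2⁻¹ * (E i).indicator 1 ω = 1 := by
    intro i ω
    by_cases h : ω ∈ E i
    · simp [K, h, ENNReal.inv_two_add_inv_two]
    · simp [K, h]
  have hlog2 : 0 < Real.log 2 := Real.log_pos one_lt_two
  have hstep' : ∀ i < m, ∀ f : Ω → ℝ≥0∞, Measurable[ℱ i] f →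
      ∫⁻ ω in A i, f ω * K (i + 1) ω ∂P ≤
        ENNReal.ofReal (Real.exp (-(p / 2))) * ∫⁻ ω in A i, f ω ∂P := by
    intro i hi f hf
    have hf' : Measurable f := hf.mono (ℱ.le i) le_rfl
    -- Finiteness is needed to subtract below; if the integral is infinite, the right-hand side is
    -- too.
    by_cases htop : ∫⁻ ω in A i, f ω ∂P = ∞
    · rw [htop, ENNReal.mul_top (by simp [Real.exp_pos])]
      exact le_top
    have h1 : ∫⁻ ω in A i, f ω * K (i + 1) ω ∂P +
        2⁻¹ * ∫⁻ ω in A i, f ω * (E (i + 1)).indicator 1 ω ∂P = ∫⁻ ω in A i, f ω ∂P := by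
      have e1 : Measurable fun ω => f ω * (E (i + 1)).indicator 1 ω :=
        hf'.mul (measurable_one.indicator (hE' (i + 1)))
      have e2 : Measurable fun ω => f ω * K (i + 1) ω := hf'.mul (hK' (i + 1))
      rw [← lintegral_const_mul _ e1, ← lintegral_add_left e2]
      refine lintegral_congr fun ω => ?_
      rw [mul_left_comm, ← mul_add, hsum, mul_one]
    have h2 : ∫⁻ ω in A i, f ω * K (i + 1) ω ∂P +
        2⁻¹ * (ENNReal.ofReal p * ∫⁻ ω in A i, f ω ∂P) ≤ ∫⁻ ω in A i, f ω ∂P :=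
      (by gcongr; exact hstep i hi f hf : _ ≤ _).trans h1.le
    have hJ : ∫⁻ ω in A i, f ω * K (i + 1) ω ∂P ≠ ∞ :=
      ne_top_of_le_ne_top htop (le_self_add.trans h2)
    generalize ∫⁻ ω in A i, f ω * K (i + 1) ω ∂P = J at *
    generalize ∫⁻ ω in A i, f ω ∂P = I at *
    lift I to ℝ≥0 using htop
    lift J to ℝ≥0 using hJ
    have h3 : J + 2⁻¹ * (p.toNNReal * I) ≤ I := by
      rw [ENNReal.ofReal, ← ENNReal.coe_two, ← ENNReal.coe_inv two_ne_zero] at h2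
      exact_mod_cast h2
    have h4 : (J : ℝ) + 2⁻¹ * (p * I) ≤ I := by
      have : ((J + 2⁻¹ * (p.toNNReal * I) : ℝ≥0) : ℝ) ≤ I := by exact_mod_cast h3
      simpa [Real.coe_toNNReal p hp] using this
    have h5 : (J : ℝ) ≤ Real.exp (-(p / 2)) * I := by
      have := Real.add_one_le_exp (-(p / 2))
      nlinarith [I.coe_nonneg]
    rw [ENNReal.ofReal, ← ENNReal.coe_mul, ENNReal.coe_le_coe, ← NNReal.coe_le_coe, NNReal.coe_mul,
      Real.coe_toNNReal _ (Real.exp_pos _).le]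
    exact h5
  have hmain := lintegral_prod_le_pow ℱ hK hA hstep'
  have hprod : ∀ ω, ∏ i ∈ Finset.range m, K (i + 1) ω = ENNReal.ofReal
      (Real.exp (-(Real.log 2 * ∑ i ∈ Finset.range m, (E (i + 1)).indicator (1 : Ω → ℝ) ω))) := by
    intro ω
    rw [Finset.mul_sum, ← Finset.sum_neg_distrib, Real.exp_sum,
      ENNReal.ofReal_prod_of_nonneg fun i _ => (Real.exp_pos _).le]
    refine Finset.prod_congr rfl fun i _ => ?_
    by_cases h : ω ∈ E (i + 1)
    · simp [K, h, Real.exp_neg, Real.exp_log, ENNReal.ofReal_inv_of_pos]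
    · simp [K, h]
  have hAm' : MeasurableSet (A m) := ℱ.le m _ (hAm m)
  have hT : MeasurableSet {ω | ∑ i ∈ Finset.range m, (E (i + 1)).indicator (1 : Ω → ℝ) ω
      < p * m / 2} :=
    measurableSet_lt (Finset.measurable_fun_sum _ fun i _ =>
      measurable_one.indicator (hE' (i + 1))) measurable_const
  -- Markov's inequality: on the event the product exceeds exp(-log 2 · p m / 2), while its mean is
  -- at most exp(-p m / 2). The quotient yields the constant 1 - log 2.
  have hmarkov : ENNReal.ofReal (Real.exp (-(Real.log 2 * (p * m / 2)))) *
      P (A m ∩ {ω | ∑ i ∈ Finset.range m, (E (i + 1)).indicator (1 : Ω → ℝ) ω < p * m / 2}) ≤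
      ENNReal.ofReal (Real.exp (-(p / 2))) ^ m := by
    refine le_trans ?_ hmain
    rw [← setLIntegral_const]
    refine le_trans (setLIntegral_mono' (hAm'.inter hT) fun ω hω => ?_)
      (lintegral_mono_set inter_subset_left)
    rw [hprod]
    refine ENNReal.ofReal_le_ofReal (Real.exp_le_exp.2 ?_)
    exact neg_le_neg (mul_le_mul_of_nonneg_left (le_of_lt hω.2) hlog2.le)
  have hpos : 0 < Real.exp (-(Real.log 2 * (p * m / 2))) := Real.exp_pos _
  rw [mul_comm, ← ENNReal.le_div_iff_mul_le (by simp [hpos]) (by simp), ← ENNReal.ofReal_pow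
    (Real.exp_pos _).le, ← ENNReal.ofReal_div_of_pos hpos, ← Real.exp_nat_mul, ← Real.exp_sub]
    at hmarkov
  refine hmarkov.trans_eq ?_
  congr 2
  ring

end Probability

end SysId

namespace SysId

/-! ### Self-normalized tail bounds. -/

section SelfNormalized

variable {Ω : Type*}

/-- The second exponential moment of a Gaussian, in the form needed below. -/
theorem lintegral_exp_sq_gaussianReal {c : ℝ≥0} (hc : c ≠ 0) {v : ℝ} (hv : 0 < v) (s : ℝ) :
    ∫⁻ η, ENNReal.ofReal (Real.exp (c * η ^ 2 / 2))
        ∂(gaussianReal (s / (c * (1 + v))) (Real.toNNReal (v / (1 + v) / c))) =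
      ENNReal.ofReal (√(1 + v) * Real.exp (s ^ 2 / (2 * c * (1 + v)))) := by
  have hc' : (0 : ℝ) < c := by positivity
  have h1v : 0 < 1 + v := by positivity
  have ha : 0 < v / (1 + v) / c := by positivity
  have ha' : Real.toNNReal (v / (1 + v) / c) ≠ 0 := by simpa using ha
  have hb' : Real.toNNReal (v / c) ≠ 0 := by
    have : 0 < v / c := by positivity
    simpa using this
  rw [gaussianReal_of_var_ne_zero _ ha',
    lintegral_withDensity_eq_lintegral_mul _ (measurable_gaussianPDF _ _) (by fun_prop)]
  -- Completing the square: the factor exp(c η² / 2) lowers the precision c (1 + v) / v by c to c /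
  -- v, so the product is a multiple of another Gaussian density.
  have hpt : ∀ η : ℝ, (gaussianPDF (s / (c * (1 + v))) (Real.toNNReal (v / (1 + v) / c)) *
      fun η => ENNReal.ofReal (Real.exp (c * η ^ 2 / 2))) η =
      ENNReal.ofReal (√(1 + v) * Real.exp (s ^ 2 / (2 * c * (1 + v)))) *
        gaussianPDF (s / c) (Real.toNNReal (v / c)) η := by
    intro η
    rw [Pi.mul_apply, gaussianPDF, gaussianPDF, ← ENNReal.ofReal_mul (gaussianPDFReal_nonneg _ _ _),
      ← ENNReal.ofReal_mul (by positivity), gaussianPDFReal, gaussianPDFReal,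
      Real.coe_toNNReal _ ha.le, Real.coe_toNNReal _ (by positivity : 0 ≤ v / c)]
    congr 1
    have hsq : √(2 * Real.pi * (v / c)) = √(1 + v) * √(2 * Real.pi * (v / (1 + v) / c)) := by
      rw [← Real.sqrt_mul h1v.le]
      congr 1
      field_simp
    have hne : √(2 * Real.pi * (v / (1 + v) / c)) ≠ 0 := by positivity
    have hne' : √(1 + v) ≠ 0 := by positivity
    rw [hsq, mul_assoc, ← Real.exp_add, mul_inv]
    have hexp : -(η - s / (c * (1 + v))) ^ 2 / (2 * (v / (1 + v) / c)) + c * η ^ 2 / 2 =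
        s ^ 2 / (2 * c * (1 + v)) + -(η - s / c) ^ 2 / (2 * (v / c)) := by
      field_simp
      ring
    rw [hexp, Real.exp_add]
    field_simp
  rw [lintegral_congr hpt, lintegral_const_mul _ (measurable_gaussianPDF _ _),
    lintegral_gaussianPDF_eq_one _ hb', mul_one]

theorem lintegral_exp_le_of_hasSubgaussianMGF {mΩ : MeasurableSpace Ω} {P : Measure Ω}
    {w : Ω → ℝ} {c : ℝ≥0} (hw : HasSubgaussianMGF w c P) (t : ℝ) :
    ∫⁻ ω, ENNReal.ofReal (Real.exp (t * w ω)) ∂P ≤ ENNReal.ofReal (Real.exp (c * t ^ 2 / 2)) := by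
  rw [← ofReal_integral_eq_lintegral_ofReal (hw.integrable_exp_mul t)
    (ae_of_all _ fun ω => (Real.exp_pos _).le)]
  exact ENNReal.ofReal_le_ofReal (hw.mgf_le t)

/-- Exponential moment of a quadratic function of a sub-Gaussian variable. -/
theorem lintegral_exp_quadratic_le {mΩ : MeasurableSpace Ω} {P : Measure Ω} [IsProbabilityMeasure P]
    {w : Ω → ℝ} {c : ℝ≥0} (hc : c ≠ 0) (hwm : Measurable w) (hw : HasSubgaussianMGF w c P)
    {v : ℝ} (hv : 0 ≤ v) (s : ℝ) :
    ∫⁻ ω, ENNReal.ofReal (Real.exp ((v * w ω ^ 2 + 2 * s * w ω - s ^ 2) / (2 * c * (1 + v)))) ∂P ≤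
      ENNReal.ofReal √(1 + v) := by
  have hc' : (0 : ℝ) < c := by positivity
  have h1v : 0 < 1 + v := by positivity
  -- For `v = 0` the exponent is linear in `w` and the sub-Gaussian bound applies directly; the
  -- Gaussian `ν` below would be degenerate.
  rcases hv.eq_or_lt with rfl | hv
  · have hpt : ∀ ω, ENNReal.ofReal (Real.exp ((0 * w ω ^ 2 + 2 * s * w ω - s ^ 2) /
        (2 * c * (1 + 0)))) = ENNReal.ofReal (Real.exp (s / c * w ω)) *
          ENNReal.ofReal (Real.exp (-(s ^ 2 / (2 * c)))) := by
      intro ω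
      rw [← ENNReal.ofReal_mul (Real.exp_pos _).le, ← Real.exp_add]
      congr 2
      field_simp
      ring
    rw [lintegral_congr hpt, lintegral_mul_const _ (by fun_prop)]
    refine (mul_le_mul_left (lintegral_exp_le_of_hasSubgaussianMGF hw _) _).trans_eq ?_
    rw [← ENNReal.ofReal_mul (Real.exp_pos _).le, ← Real.exp_add]
    have : (c : ℝ) * (s / c) ^ 2 / 2 + -(s ^ 2 / (2 * c)) = 0 := by field_simp; ring
    rw [this]
    simp
  -- Linearisation of the square: the moment generating function of `ν` at `w ω` is the desired
  -- exponential up to the term in s². After exchanging integrals, only the exponent η w, linear in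
  -- `w`, has to be integrated.
  set ν := gaussianReal (s / (c * (1 + v))) (Real.toNNReal (v / (1 + v) / c)) with hν
  have hmgf : ∀ x : ℝ, ∫⁻ η, ENNReal.ofReal (Real.exp (x * η)) ∂ν =
      ENNReal.ofReal (Real.exp (s / (c * (1 + v)) * x + v / (1 + v) / c * x ^ 2 / 2)) := by
    intro x
    have h := congrFun (mgf_id_gaussianReal (μ := s / (c * (1 + v)))
      (v := Real.toNNReal (v / (1 + v) / c))) x
    rw [Real.coe_toNNReal _ (by positivity)] at h
    rw [← h, mgf]
    change _ = ENNReal.ofReal (∫ η, Real.exp (x * η) ∂ν)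
    rw [ofReal_integral_eq_lintegral_ofReal (integrable_exp_mul_gaussianReal x)
      (ae_of_all _ fun ω => (Real.exp_pos _).le)]
  have hpt : ∀ ω, ENNReal.ofReal (Real.exp ((v * w ω ^ 2 + 2 * s * w ω - s ^ 2) /
      (2 * c * (1 + v)))) = (∫⁻ η, ENNReal.ofReal (Real.exp (w ω * η)) ∂ν) *
        ENNReal.ofReal (Real.exp (-(s ^ 2 / (2 * c * (1 + v))))) := by
    intro ω
    rw [hmgf, ← ENNReal.ofReal_mul (Real.exp_pos _).le, ← Real.exp_add]
    congr 2
    field_simp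
    ring
  have hswap : ∫⁻ ω, ∫⁻ η, ENNReal.ofReal (Real.exp (w ω * η)) ∂ν ∂P ≤
      ENNReal.ofReal (√(1 + v) * Real.exp (s ^ 2 / (2 * c * (1 + v)))) := by
    rw [lintegral_lintegral_swap (by fun_prop), ← lintegral_exp_sq_gaussianReal hc hv s]
    refine lintegral_mono fun η => ?_
    simp_rw [mul_comm _ η]
    exact lintegral_exp_le_of_hasSubgaussianMGF hw η
  rw [lintegral_congr hpt, lintegral_mul_const _ (Measurable.lintegral_prod_right'
    (f := fun x : Ω × ℝ => ENNReal.ofReal (Real.exp (w x.1 * x.2))) (by fun_prop))]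
  refine (mul_le_mul_left hswap _).trans_eq ?_
  rw [← ENNReal.ofReal_mul (by positivity), mul_assoc, ← Real.exp_add, add_neg_cancel,
    Real.exp_zero, mul_one]

/-- The determinant of a rank one update. -/
theorem det_add_vecMulVec_self {d : ℕ} {G : Mat d d} (hG : G.PosDef) (z : Fin d → ℝ) :
    (G + Matrix.vecMulVec z z).det = G.det * (1 + z ⬝ᵥ G⁻¹.mulVec z) := by
  have h := Matrix.det_add_replicateCol_mul_replicateRow (ι := Unit) (A := G)
    hG.det_pos.ne'.isUnit z z
  rw [Matrix.vecMulVec_eq Unit, h]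
  congr 1
  simp [Matrix.det_unique, Matrix.mul_apply, Matrix.replicateRow, Matrix.replicateCol,
    dotProduct, Matrix.mulVec, Finset.mul_sum, Matrix.mul_assoc]

/-- The inverse quadratic form under a rank one update. -/
theorem quad_inv_add_vecMulVec_self {d : ℕ} {G : Mat d d} (hG : G.PosDef) (z S : Fin d → ℝ)
    (w : ℝ) :
    (S + w • z) ⬝ᵥ (G + Matrix.vecMulVec z z)⁻¹.mulVec (S + w • z) =
      S ⬝ᵥ G⁻¹.mulVec S + ((z ⬝ᵥ G⁻¹.mulVec z) * w ^ 2 + 2 * (z ⬝ᵥ G⁻¹.mulVec S) * w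
        - (z ⬝ᵥ G⁻¹.mulVec S) ^ 2) / (1 + z ⬝ᵥ G⁻¹.mulVec z) := by
  have hinv : G⁻¹.PosDef := hG.inv
  have hv : 0 ≤ z ⬝ᵥ G⁻¹.mulVec z := by
    simpa using hinv.posSemidef.dotProduct_mulVec_nonneg z
  have hsymm : S ⬝ᵥ G⁻¹.mulVec z = z ⬝ᵥ G⁻¹.mulVec S := by
    have : G⁻¹.transpose = G⁻¹ := by simpa using hinv.isHermitian.eq
    rw [Matrix.dotProduct_mulVec, ← Matrix.mulVec_transpose, this, dotProduct_comm]
  have hG' : (G + Matrix.vecMulVec z z).PosDef := by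
    refine hG.add_posSemidef ?_
    simpa using Matrix.posSemidef_vecMulVec_self_star z
  have hdet : IsUnit (G + Matrix.vecMulVec z z).det := hG'.det_pos.ne'.isUnit
  have hGz : G.mulVec (G⁻¹.mulVec z) = z := by
    rw [Matrix.mulVec_mulVec, Matrix.mul_nonsing_inv _ hG.det_pos.ne'.isUnit, Matrix.one_mulVec]
  have hGS : G.mulVec (G⁻¹.mulVec S) = S := by
    rw [Matrix.mulVec_mulVec, Matrix.mul_nonsing_inv _ hG.det_pos.ne'.isUnit, Matrix.one_mulVec]
  set x := G⁻¹.mulVec z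
  set y := G⁻¹.mulVec S
  -- The Sherman–Morrison solution, checked by applying `G + vecMulVec z z` to it.
  have hsol : (G + Matrix.vecMulVec z z)⁻¹.mulVec (S + w • z) =
      y + ((w - z ⬝ᵥ y) / (1 + z ⬝ᵥ x)) • x := by
    have : S + w • z = (G + Matrix.vecMulVec z z).mulVec
        (y + ((w - z ⬝ᵥ y) / (1 + z ⬝ᵥ x)) • x) := by
      rw [Matrix.mulVec_add, Matrix.mulVec_smul, Matrix.add_mulVec, Matrix.add_mulVec, hGz, hGS,
        Matrix.vecMulVec_mulVec, Matrix.vecMulVec_mulVec]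
      ext i
      simp
      field_simp
      ring
    rw [this, Matrix.mulVec_mulVec, Matrix.nonsing_inv_mul _ hdet, Matrix.one_mulVec]
  rw [hsol, dotProduct_add, dotProduct_smul, add_dotProduct, add_dotProduct, smul_dotProduct,
    smul_dotProduct, hsymm]
  simp only [smul_eq_mul]
  field_simp
  ring

/-- Inversion is discontinuous at singular matrices, but by Cramer's rule it is a measurable scalar
times the adjugate, and determinant and adjugate are continuous. -/
theorem measurable_matrix_inv {d : ℕ} : Measurable fun G : Mat d d => G⁻¹ := by
  have hdet : Measurable fun G : Mat d d => G.det := (continuous_id.matrix_det).measurable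
  have hadj : Measurable fun G : Mat d d => G.adjugate := (continuous_id.matrix_adjugate).measurable
  have : (fun G : Mat d d => G⁻¹) = fun G => G.det⁻¹ • G.adjugate := by
    funext G
    rw [Matrix.inv_def, Ring.inverse_eq_inv]
  rw [this]
  refine measurable_pi_lambda _ fun i => measurable_pi_lambda _ fun j => ?_
  exact hdet.inv.mul ((measurable_pi_apply j).comp ((measurable_pi_apply i).comp hadj))

/-- The regularised Gramian `γ I + ∑_{s<t} z_s z_sᵀ`. -/
def gram {d : ℕ} (γ : ℝ) (z : ℕ → Fin d → ℝ) (t : ℕ) : Mat d d :=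
  γ • 1 + ∑ s ∈ Finset.range t, Matrix.vecMulVec (z s) (z s)

/-- The cross term `∑_{s<t} w_{s+1} z_s`. -/
def cross {d : ℕ} (z : ℕ → Fin d → ℝ) (w : ℕ → ℝ) (t : ℕ) : Fin d → ℝ :=
  ∑ s ∈ Finset.range t, w (s + 1) • z s

theorem gram_succ {d : ℕ} (γ : ℝ) (z : ℕ → Fin d → ℝ) (t : ℕ) :
    gram γ z (t + 1) = gram γ z t + Matrix.vecMulVec (z t) (z t) := by
  rw [gram, Finset.sum_range_succ, ← add_assoc, gram]

theorem cross_succ {d : ℕ} (z : ℕ → Fin d → ℝ) (w : ℕ → ℝ) (t : ℕ) :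
    cross z w (t + 1) = cross z w t + w (t + 1) • z t := by
  rw [cross, Finset.sum_range_succ, cross]

theorem posDef_gram {d : ℕ} {γ : ℝ} (hγ : 0 < γ) (z : ℕ → Fin d → ℝ) (t : ℕ) :
    (gram γ z t).PosDef := by
  induction t with
  | zero => simpa [gram] using Matrix.PosDef.one.smul hγ
  | succ t ih =>
    rw [gram_succ]
    refine ih.add_posSemidef ?_
    simpa using Matrix.posSemidef_vecMulVec_self_star (z t)

theorem measurable_gram {d : ℕ} {m : MeasurableSpace Ω} (γ : ℝ) {z : ℕ → Ω → Fin d → ℝ} {t : ℕ}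
    (hz : ∀ s < t, Measurable (z s)) : Measurable fun ω => gram γ (fun s => z s ω) t := by
  refine measurable_pi_lambda _ fun i => measurable_pi_lambda _ fun j => ?_
  simp only [gram, Matrix.add_apply, Matrix.sum_apply, Matrix.vecMulVec_apply]
  refine measurable_const.add (Finset.measurable_fun_sum _ fun s hs => ?_)
  have := hz s (Finset.mem_range.1 hs)
  exact ((measurable_pi_apply i).comp this).mul ((measurable_pi_apply j).comp this)

theorem measurable_cross {d : ℕ} {m : MeasurableSpace Ω} {z : ℕ → Ω → Fin d → ℝ} {w : ℕ → Ω → ℝ}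
    {t : ℕ} (hz : ∀ s < t, Measurable (z s)) (hw : ∀ s < t, Measurable (w (s + 1))) :
    Measurable fun ω => cross (fun s => z s ω) (fun s => w s ω) t := by
  simp only [cross]
  exact Finset.measurable_fun_sum _ fun s hs =>
    (hw s (Finset.mem_range.1 hs)).smul (hz s (Finset.mem_range.1 hs))

theorem measurable_dotProduct_mulVec {d : ℕ} {m : MeasurableSpace Ω} {u v : Ω → Fin d → ℝ}
    {G : Ω → Mat d d} (hu : Measurable u) (hG : Measurable G) (hv : Measurable v) :
    Measurable fun ω => u ω ⬝ᵥ (G ω).mulVec (v ω) := by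
  simp only [dotProduct, Matrix.mulVec]
  have hG' : ∀ i j, Measurable fun ω => G ω i j := fun i j =>
    (measurable_pi_apply j).comp ((measurable_pi_apply i).comp hG)
  fun_prop

/-- The self-normalized tail bound for vector-valued martingales with sub-Gaussian noise. -/
theorem measure_exists_lt_quad_le {mΩ : MeasurableSpace Ω} {P : Measure Ω} [IsProbabilityMeasure P]
    {d : ℕ} (ℱ : Filtration ℕ mΩ) {z : ℕ → Ω → Fin d → ℝ} {w : ℕ → Ω → ℝ} {c : ℝ≥0}
    (hz : ∀ t, Measurable[ℱ t] (z t)) (hw : ∀ t, Measurable[ℱ (t + 1)] (w (t + 1)))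
    (hind : ∀ t, Indep (ℱ t) (MeasurableSpace.comap (w (t + 1)) inferInstance) P)
    (hsub : ∀ t, HasSubgaussianMGF (w (t + 1)) c P) {γ : ℝ} (hγ : 0 < γ) {ε : ℝ} (hε : 0 < ε) :
    P {ω | ∃ t, 2 * c * Real.log (√((gram γ (fun s => z s ω) t).det / γ ^ d) / ε) <
      cross (fun s => z s ω) (fun s => w s ω) t ⬝ᵥ (gram γ (fun s => z s ω) t)⁻¹.mulVec
        (cross (fun s => z s ω) (fun s => w s ω) t)} ≤ ENNReal.ofReal ε := by
  -- With zero variance proxy the noise vanishes almost surely and the event reads 0 < 0; the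
  -- supermartingale below divides by `c`.
  rcases eq_or_ne c 0 with rfl | hc
  · have h0 : ∀ᵐ ω ∂P, ∀ t, w (t + 1) ω = 0 :=
      ae_all_iff.2 fun t => (hsub t).ae_eq_zero_of_hasSubgaussianMGF_zero
    refine le_trans (le_of_eq ?_) zero_le
    refine measure_mono_null ?_ h0
    rintro ω ⟨t, ht⟩ hω
    have hω' : ∀ s, w (s + 1) ω = 0 := hω
    simp [cross, hω'] at ht
  let G : ℕ → Ω → Mat d d := fun t ω => gram γ (fun s => z s ω) t
  let S : ℕ → Ω → Fin d → ℝ := fun t ω => cross (fun s => z s ω) (fun s => w s ω) t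
  let V : ℕ → Ω → ℝ := fun t ω => z t ω ⬝ᵥ (G t ω)⁻¹.mulVec (z t ω)
  let B : ℕ → Ω → ℝ := fun t ω => z t ω ⬝ᵥ (G t ω)⁻¹.mulVec (S t ω)
  -- The method-of-mixtures supermartingale. Its one-step ratio depends on the past only through the
  -- leverage `V` and the cross value `B`, which is the form of `lintegral_exp_quadratic_le`.
  let M : ℕ → Ω → ℝ := fun t ω => (√((G t ω).det / γ ^ d))⁻¹ *
    Real.exp (S t ω ⬝ᵥ (G t ω)⁻¹.mulVec (S t ω) / (2 * c))
  have hc' : (0 : ℝ) < c := by positivity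
  have hpos : ∀ t ω, (G t ω).PosDef := fun t ω => posDef_gram hγ _ t
  have hV : ∀ t ω, 0 ≤ V t ω := fun t ω => by
    simpa using (hpos t ω).inv.posSemidef.dotProduct_mulVec_nonneg (z t ω)
  have hz' : ∀ s t, s ≤ t → Measurable[ℱ t] (z s) := fun s t h => (hz s).mono (ℱ.mono h) le_rfl
  have hGm : ∀ t, Measurable[ℱ t] (G t) := fun t =>
    measurable_gram (m := ℱ t) γ fun s hs => hz' s t hs.le
  have hGi : ∀ t, Measurable[ℱ t] fun ω => (G t ω)⁻¹ := fun t => measurable_matrix_inv.comp (hGm t)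
  have hSm : ∀ t, Measurable[ℱ t] (S t) := fun t =>
    measurable_cross (m := ℱ t) (fun s hs => hz' s t hs.le)
      fun s hs => (hw s).mono (ℱ.mono hs) le_rfl
  have hVm : ∀ t, Measurable[ℱ t] (V t) := fun t =>
    measurable_dotProduct_mulVec (m := ℱ t) (hz t) (hGi t) (hz t)
  have hBm : ∀ t, Measurable[ℱ t] (B t) := fun t =>
    measurable_dotProduct_mulVec (m := ℱ t) (hz t) (hGi t) (hSm t)
  have hMm : ∀ t, Measurable[ℱ t] (M t) := by
    intro t
    have h1 : Measurable[ℱ t] fun ω => (G t ω).det :=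
      ((continuous_id.matrix_det).measurable : Measurable fun A : Mat d d => A.det).comp (hGm t)
    have h2 : Measurable[ℱ t] fun ω => S t ω ⬝ᵥ (G t ω)⁻¹.mulVec (S t ω) :=
      measurable_dotProduct_mulVec (m := ℱ t) (hSm t) (hGi t) (hSm t)
    exact ((h1.div_const _).sqrt.inv).mul (h2.div_const _).exp
  have hMpos : ∀ t ω, 0 < M t ω := fun t ω => by
    have := (hpos t ω).det_pos
    positivity
  have hMsucc : ∀ t ω, M (t + 1) ω = M t ω * ((√(1 + V t ω))⁻¹ *
      Real.exp ((V t ω * w (t + 1) ω ^ 2 + 2 * B t ω * w (t + 1) ω - B t ω ^ 2) /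
        (2 * c * (1 + V t ω)))) := by
    intro t ω
    have hG1 : G (t + 1) ω = G t ω + Matrix.vecMulVec (z t ω) (z t ω) := gram_succ _ _ _
    have hS1 : S (t + 1) ω = S t ω + w (t + 1) ω • z t ω := cross_succ _ _ _
    have h1 := hV t ω
    have h2 := (hpos t ω).det_pos
    simp only [M]
    rw [hG1, hS1, quad_inv_add_vecMulVec_self (hpos t ω), det_add_vecMulVec_self (hpos t ω)]
    change (√((G t ω).det * (1 + V t ω) / γ ^ d))⁻¹ * Real.exp ((_ + (V t ω * w (t + 1) ω ^ 2 +
      2 * B t ω * w (t + 1) ω - B t ω ^ 2) / (1 + V t ω)) / (2 * c)) = _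
    rw [add_div, Real.exp_add, mul_div_right_comm, Real.sqrt_mul (by positivity), mul_inv, div_div,
      mul_comm (1 + V t ω) (2 * (c : ℝ))]
    ring
  let N : ℕ → Ω → ℝ≥0∞ := fun t ω => ENNReal.ofReal (M t ω)
  have hNm : ∀ t, Measurable[ℱ t] (N t) := fun t => (hMm t).ennreal_ofReal
  have hstep : ∀ t A, MeasurableSet[ℱ t] A →
      ∫⁻ ω in A, N (t + 1) ω ∂P ≤ ∫⁻ ω in A, N t ω ∂P := by
    intro t A hA
    have hwm : Measurable (w (t + 1)) := (hw t).mono (ℱ.le _) le_rfl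
    let F : (ℝ × ℝ) × ℝ → ℝ≥0∞ := fun x => ENNReal.ofReal ((√(1 + x.1.1))⁻¹) *
      ENNReal.ofReal (Real.exp ((x.1.1 * x.2 ^ 2 + 2 * x.1.2 * x.2 - x.1.2 ^ 2) /
        (2 * c * (1 + x.1.1))))
    have hF : Measurable F := by
      simp only [F]
      fun_prop
    have hfA : Measurable[ℱ t] (A.indicator (N t)) := (hNm t).indicator hA
    have hfreeze := lintegral_mul_comp_of_indep (ℱ.le t) hwm (hind t)
      ((hVm t).prodMk (hBm t)) hfA hF
    -- The determinant grows by the factor 1 + V, and √(1 + V) is exactly the bound on the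
    -- exponential moment: the two cancel.
    have hle : ∀ ω, ∫⁻ y, F ((V t ω, B t ω), y) ∂(P.map (w (t + 1))) ≤ 1 := by
      intro ω
      have h1 := hV t ω
      rw [lintegral_map (by fun_prop) hwm]
      simp only [F]
      rw [lintegral_const_mul _ (by fun_prop)]
      refine (mul_le_mul_right (lintegral_exp_quadratic_le hc hwm (hsub t) h1 _) _).trans_eq ?_
      rw [← ENNReal.ofReal_mul (by positivity), inv_mul_cancel₀ (by positivity),
        ENNReal.ofReal_one]
    have hA' := ℱ.le t _ hA
    calc ∫⁻ ω in A, N (t + 1) ω ∂P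
        = ∫⁻ ω, A.indicator (N t) ω * F ((V t ω, B t ω), w (t + 1) ω) ∂P := by
          rw [← lintegral_indicator hA']
          refine lintegral_congr fun ω => ?_
          by_cases hω : ω ∈ A
          · simp only [hω, indicator_of_mem, N, F]
            rw [hMsucc, ENNReal.ofReal_mul (hMpos t ω).le,
              ENNReal.ofReal_mul (inv_nonneg.2 (Real.sqrt_nonneg (1 + V t ω)))]
          · simp [hω]
      _ = ∫⁻ ω, A.indicator (N t) ω *
            ∫⁻ y, F ((V t ω, B t ω), y) ∂(P.map (w (t + 1))) ∂P := hfreeze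
      _ ≤ ∫⁻ ω, A.indicator (N t) ω ∂P := by
          refine lintegral_mono fun ω => ?_
          exact (mul_le_mul_right (hle ω) _).trans_eq (mul_one _)
      _ = ∫⁻ ω in A, N t ω ∂P := lintegral_indicator hA' _
  -- Ville's inequality at level 1/ε; the initial value is 1 because the empty Gramian has
  -- determinant γ^d.
  have hville := mul_measure_exists_le ℱ hNm hstep (ENNReal.ofReal ε⁻¹)
  have hN0 : ∫⁻ ω, N 0 ω ∂P = 1 := by
    have : ∀ ω, N 0 ω = 1 := by
      intro ω
      have hγd : γ ^ d ≠ 0 := by positivity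
      simp [N, M, G, S, gram, cross, hγd]
    simp [this]
  rw [hN0, mul_comm, ← ENNReal.le_div_iff_mul_le (by simp [hε]) (by simp), one_div,
    ENNReal.ofReal_inv_of_pos hε, inv_inv] at hville
  refine le_trans (measure_mono ?_) hville
  rintro ω ⟨t, ht⟩
  refine ⟨t, ?_⟩
  rw [← ENNReal.ofReal_inv_of_pos hε]
  refine ENNReal.ofReal_le_ofReal ?_
  have hdet : 0 < √((G t ω).det / γ ^ d) := by
    have := (hpos t ω).det_pos
    positivity
  change 2 * c * Real.log (√((G t ω).det / γ ^ d) / ε) < S t ω ⬝ᵥ (G t ω)⁻¹.mulVec (S t ω) at ht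
  have h1 : √((G t ω).det / γ ^ d) / ε ≤
      Real.exp (S t ω ⬝ᵥ (G t ω)⁻¹.mulVec (S t ω) / (2 * c)) := by
    rw [← Real.log_le_iff_le_exp (by positivity), le_div_iff₀ (by positivity), mul_comm]
    exact ht.le
  simp only [M]
  rw [inv_mul_eq_div, le_div_iff₀ hdet, inv_mul_eq_div]
  exact h1

end SelfNormalized

end SysId

namespace SysId

/-! ### Nets of the sphere, Gramian bounds and the deterministic error estimate. -/

section LinearAlgebra

/-- A separated family of unit vectors has bounded cardinality. -/
theorem card_le_of_separated_sphere {d : ℕ} {ε : ℝ} (hε : 0 < ε) (N : Finset (Vec d))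
    (hN : ∀ x ∈ N, ‖x‖ = 1) (hsep : ∀ x ∈ N, ∀ y ∈ N, x ≠ y → ε < ‖x - y‖) :
    (N.card : ℝ) ≤ (1 + 2 / ε) ^ d := by
  -- Volume packing: balls of radius ε/2 about the points are disjoint and lie in the ball of radius
  -- 1 + ε/2, and the ratio of the radii is 1 + 2/ε.
  let μ : Measure (Vec d) := volume
  have hδ : 0 < ε / 2 := by positivity
  have hρ : 0 < 1 + ε / 2 := by positivity
  have D : Set.Pairwise (N : Set (Vec d))
      (Function.onFun Disjoint fun c => Metric.ball c (ε / 2)) := by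
    intro x hx y hy hxy
    apply Metric.ball_disjoint_ball
    rw [dist_eq_norm]
    linarith [hsep x hx y hy hxy]
  have hsub : (⋃ c ∈ N, Metric.ball c (ε / 2)) ⊆ Metric.ball (0 : Vec d) (1 + ε / 2) := by
    refine iUnion₂_subset fun x hx => Metric.ball_subset_ball' ?_
    rw [dist_zero_right, hN x hx, add_comm]
  have I : (N.card : ℝ≥0∞) * ENNReal.ofReal ((ε / 2) ^ Module.finrank ℝ (Vec d)) *
      μ (Metric.ball 0 1) ≤
      ENNReal.ofReal ((1 + ε / 2) ^ Module.finrank ℝ (Vec d)) * μ (Metric.ball 0 1) :=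
    calc _ = μ (⋃ c ∈ N, Metric.ball c (ε / 2)) := by
          rw [measure_biUnion_finset D fun c _ => measurableSet_ball]
          simp only [μ.addHaar_ball_of_pos _ hδ]
          simp only [Finset.sum_const, nsmul_eq_mul, mul_assoc]
      _ ≤ μ (Metric.ball (0 : Vec d) (1 + ε / 2)) := measure_mono hsub
      _ = _ := by simp only [μ.addHaar_ball_of_pos _ hρ]
  have J := (ENNReal.mul_le_mul_iff_left (Metric.measure_ball_pos _ _ zero_lt_one).ne'
    measure_ball_lt_top.ne).1 I
  have K := ENNReal.toReal_le_of_le_ofReal (pow_nonneg hρ.le _) J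
  rw [ENNReal.toReal_mul, ENNReal.toReal_ofReal (by positivity), finrank_euclideanSpace_fin,
    ENNReal.toReal_natCast, ← le_div_iff₀ (by positivity), ← div_pow] at K
  refine K.trans_eq ?_
  congr 1
  field_simp
  ring

/-- Existence of small nets of the unit sphere. -/
theorem exists_sphere_net {d : ℕ} {ε : ℝ} (hε : 0 < ε) :
    ∃ N : Finset (Vec d), (∀ x ∈ N, ‖x‖ = 1) ∧ (∀ u : Vec d, ‖u‖ = 1 → ∃ x ∈ N, ‖u - x‖ ≤ ε) ∧
      (N.card : ℝ) ≤ (1 + 2 / ε) ^ d := by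
  classical
  let good : Finset (Vec d) → Prop := fun N =>
    (∀ x ∈ N, ‖x‖ = 1) ∧ ∀ x ∈ N, ∀ y ∈ N, x ≠ y → ε < ‖x - y‖
  let cards : Set ℕ := {k | ∃ N, good N ∧ N.card = k}
  have hne : cards.Nonempty := ⟨0, ∅, ⟨by simp, by simp⟩, rfl⟩
  have hbdd : BddAbove cards := by
    refine ⟨⌊(1 + 2 / ε) ^ d⌋₊, ?_⟩
    rintro _ ⟨N, hN, rfl⟩
    exact Nat.le_floor (card_le_of_separated_sphere hε N hN.1 hN.2)
  -- A separated set of maximal cardinality is a net: a unit vector farther than ε from all its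
  -- points could be added.
  obtain ⟨N, hN, hcard⟩ := Nat.sSup_mem hne hbdd
  refine ⟨N, hN.1, fun u hu => ?_, card_le_of_separated_sphere hε N hN.1 hN.2⟩
  by_contra! h
  have hu' : u ∉ N := fun hmem => by
    have := h u hmem
    simp only [sub_self, norm_zero] at this
    linarith
  have hgood : good (insert u N) := by
    refine ⟨fun x hx => ?_, fun x hx y hy hxy => ?_⟩
    · rcases Finset.mem_insert.1 hx with rfl | hx
      · exact hu
      · exact hN.1 x hx
    · rcases Finset.mem_insert.1 hx with rfl | hx <;> rcases Finset.mem_insert.1 hy with rfl | hy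
      · exact absurd rfl hxy
      · exact h y hy
      · rw [norm_sub_rev]; exact h x ‹x ∈ N›
      · exact hN.2 x hx y hy hxy
  have := le_csSup hbdd ⟨insert u N, hgood, rfl⟩
  rw [Finset.card_insert_of_notMem hu', hcard] at this
  omega

/-- A net of the unit sphere on which a quadratic form of size `S` varies by at most `κ`. -/
theorem exists_sphere_net_mul_le {d : ℕ} (hd : 0 < d) {S κ : ℝ} (hS : 0 ≤ S) (hκ : 0 < κ) :
    ∃ N : Finset (Vec d), (∀ x ∈ N, ‖x‖ = 1) ∧
      (∀ u : Vec d, ‖u‖ = 1 → ∃ x ∈ N, ‖u - x‖ * S ≤ κ) ∧ (N.card : ℝ) ≤ (1 + 2 * S / κ) ^ d := by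
  -- The resolution κ / S is meaningless for `S = 0`; then any single unit vector will do, which
  -- requires `0 < d`.
  rcases hS.eq_or_lt with rfl | hS
  · refine ⟨{EuclideanSpace.single ⟨0, hd⟩ 1}, by simp, fun u _ => ?_, by simp⟩
    exact ⟨_, Finset.mem_singleton_self _, by simpa using hκ.le⟩
  · obtain ⟨N, h1, h2, h3⟩ := exists_sphere_net (d := d) (div_pos hκ hS)
    refine ⟨N, h1, fun u hu => ?_, ?_⟩
    · obtain ⟨x, hx, hux⟩ := h2 u hu
      exact ⟨x, hx, (le_div_iff₀ hS).1 hux⟩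
    · rwa [div_div_eq_mul_div] at h3

/-- A lower bound on a sum of squares of inner products propagates to nearby unit vectors. -/
theorem sum_inner_sq_ge_of_near {d : ℕ} {ι : Type*} (s : Finset ι) (z : ι → Vec d) {S κ a : ℝ}
    (hS : ∑ i ∈ s, ‖z i‖ ^ 2 ≤ S) {u x : Vec d} (hu : ‖u‖ = 1) (hx : ‖x‖ = 1)
    (hux : ‖u - x‖ * S ≤ κ) (ha : a ≤ ∑ i ∈ s, inner ℝ x (z i) ^ 2) :
    a - 2 * κ ≤ ∑ i ∈ s, inner ℝ u (z i) ^ 2 := by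
  have h1 : ∀ i, inner ℝ x (z i) ^ 2 - inner ℝ u (z i) ^ 2 ≤ 2 * ‖u - x‖ * ‖z i‖ ^ 2 := by
    intro i
    -- A difference of squares: one factor is small with ‖u - x‖, the other is at most 2 ‖z i‖.
    have e : inner ℝ x (z i) ^ 2 - inner ℝ u (z i) ^ 2 =
        -(inner ℝ (u - x) (z i) * inner ℝ (u + x) (z i)) := by
      rw [inner_sub_left, inner_add_left]; ring
    have b1 := abs_real_inner_le_norm (u - x) (z i)
    have b2 := abs_real_inner_le_norm (u + x) (z i)
    have b3 : ‖u + x‖ ≤ 2 := (norm_add_le u x).trans (by rw [hu, hx]; norm_num)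
    rw [e]
    refine (neg_le_abs _).trans ?_
    rw [abs_mul]
    calc _ ≤ (‖u - x‖ * ‖z i‖) * (‖u + x‖ * ‖z i‖) := by gcongr
      _ ≤ (‖u - x‖ * ‖z i‖) * (2 * ‖z i‖) := by gcongr
      _ = _ := by ring
  have h2 := Finset.sum_le_sum fun i (_ : i ∈ s) => h1 i
  rw [Finset.sum_sub_distrib, ← Finset.mul_sum] at h2
  have h3 : 2 * ‖u - x‖ * ∑ i ∈ s, ‖z i‖ ^ 2 ≤ 2 * ‖u - x‖ * S := by gcongr
  linarith

/-- Translates between the spectrum of the Gramian and sums of squared inner products; it serves the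
upper bound on the determinant as well as the lower bound from excitation. -/
theorem dotProduct_gram_mulVec {d : ℕ} (γ : ℝ) (z : ℕ → Fin d → ℝ) (t : ℕ) (u : Fin d → ℝ) :
    u ⬝ᵥ (gram γ z t).mulVec u = γ * (u ⬝ᵥ u) + ∑ s ∈ Finset.range t, (u ⬝ᵥ z s) ^ 2 := by
  induction t with
  | zero => simp [gram, Matrix.smul_mulVec]
  | succ t ih =>
    rw [gram_succ, Matrix.add_mulVec, dotProduct_add, ih, Finset.sum_range_succ,
      Matrix.vecMulVec_mulVec]
    simp only [op_smul_eq_smul, dotProduct_smul, smul_eq_mul]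
    rw [dotProduct_comm (z t) u]
    ring

theorem dotProduct_self_eq_norm_sq {d : ℕ} (u : Vec d) : u.ofLp ⬝ᵥ u.ofLp = ‖u‖ ^ 2 := by
  rw [EuclideanSpace.real_norm_sq_eq]
  simp [dotProduct, sq]

theorem inner_eq_ofLp_dotProduct {d : ℕ} (u v : Vec d) : inner ℝ u v = u.ofLp ⬝ᵥ v.ofLp := by
  rw [EuclideanSpace.inner_eq_star_dotProduct, dotProduct_comm]
  simp

theorem sq_dotProduct_le {d : ℕ} (u v : Fin d → ℝ) :
    (u ⬝ᵥ v) ^ 2 ≤ (u ⬝ᵥ u) * (v ⬝ᵥ v) := by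
  simpa [dotProduct, sq] using Finset.sum_mul_sq_le_sq_mul_sq Finset.univ u v

/-- The determinant of the Gramian is at most `(γ + ∑ |z_s|²)^d`. -/
theorem det_gram_le {d : ℕ} {γ : ℝ} (hγ : 0 < γ) (z : ℕ → Fin d → ℝ) (t : ℕ) {β : ℝ}
    (hβ : ∑ s ∈ Finset.range t, z s ⬝ᵥ z s + γ ≤ β) : (gram γ z t).det ≤ β ^ d := by
  have hpos := posDef_gram hγ z t
  rw [hpos.isHermitian.det_eq_prod_eigenvalues]
  -- An eigenvalue is the quadratic form at a unit eigenvector, where Cauchy–Schwarz bounds each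
  -- summand by |z_s|².
  have hle : ∀ i, hpos.isHermitian.eigenvalues i ≤ β := by
    intro i
    have h1 := hpos.isHermitian.eigenvalues_eq i
    set u : Vec d := hpos.isHermitian.eigenvectorBasis i with hu
    have hnorm : u.ofLp ⬝ᵥ u.ofLp = 1 := by
      rw [dotProduct_self_eq_norm_sq, hpos.isHermitian.eigenvectorBasis.norm_eq_one]
      norm_num
    have h2 : hpos.isHermitian.eigenvalues i = u.ofLp ⬝ᵥ (gram γ z t).mulVec u.ofLp := by
      simpa using h1
    rw [h2, dotProduct_gram_mulVec, hnorm]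
    have h3 : ∑ s ∈ Finset.range t, (u.ofLp ⬝ᵥ z s) ^ 2 ≤ ∑ s ∈ Finset.range t, z s ⬝ᵥ z s :=
      Finset.sum_le_sum fun s _ => (sq_dotProduct_le _ _).trans_eq (by rw [hnorm, one_mul])
    linarith
  calc _ ≤ ∏ _i : Fin d, β :=
        Finset.prod_le_prod (fun i _ => (hpos.eigenvalues_pos i).le) fun i _ => hle i
    _ = β ^ d := by simp

/-- The Cauchy–Schwarz inequality for the pairing of a positive definite form and its inverse. -/
theorem dotProduct_le_sqrt_mul_sqrt {d : ℕ} {G : Mat d d} (hG : G.PosDef) (u S : Fin d → ℝ) :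
    |u ⬝ᵥ S| ≤ √(u ⬝ᵥ G.mulVec u) * √(S ⬝ᵥ G⁻¹.mulVec S) := by
  have hGS : G.mulVec (G⁻¹.mulVec S) = S := by
    rw [Matrix.mulVec_mulVec, Matrix.mul_nonsing_inv _ hG.det_pos.ne'.isUnit, Matrix.one_mulVec]
  have hnn : ∀ x : Fin d → ℝ, 0 ≤ x ⬝ᵥ G.mulVec x := fun x => by
    simpa using hG.posSemidef.dotProduct_mulVec_nonneg x
  have hsymm : ∀ x y : Fin d → ℝ, x ⬝ᵥ G.mulVec y = y ⬝ᵥ G.mulVec x := fun x y => by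
    have : G.transpose = G := by simpa using hG.isHermitian.eq
    rw [Matrix.dotProduct_mulVec, ← Matrix.mulVec_transpose, this, dotProduct_comm]
  set y := G⁻¹.mulVec S
  have hq : S ⬝ᵥ y = y ⬝ᵥ G.mulVec y := by rw [hGS, dotProduct_comm]
  -- Nonnegativity of the form at u + τ y with y = G⁻¹ S; the discriminant gives the claim because u
  -- · S = u · G y.
  have hdisc : ∀ τ : ℝ, 0 ≤ (y ⬝ᵥ G.mulVec y) * (τ * τ) + (2 * (u ⬝ᵥ G.mulVec y)) * τ +
      u ⬝ᵥ G.mulVec u := by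
    intro τ
    have := hnn (u + τ • y)
    simp only [Matrix.mulVec_add, Matrix.mulVec_smul, dotProduct_add, add_dotProduct,
      dotProduct_smul, smul_dotProduct, smul_eq_mul, hsymm y u] at this
    linarith
  have h := discrim_le_zero hdisc
  rw [discrim] at h
  rw [← Real.sqrt_mul (hnn u), hq]
  apply Real.abs_le_sqrt
  rw [hGS] at h hq ⊢
  nlinarith

theorem frobNorm_nonneg {d n : ℕ} (A : Mat d n) : 0 ≤ frobNorm A := Real.sqrt_nonneg _

theorem norm_mulVec_le_frobNorm {d n : ℕ} (A : Mat d n) (v : Vec n) :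
    ‖(WithLp.toLp 2 (A.mulVec v.ofLp) : Vec d)‖ ≤ frobNorm A * ‖v‖ := by
  refine le_of_sq_le_sq ?_ (mul_nonneg (frobNorm_nonneg A) (norm_nonneg v))
  rw [mul_pow, frobNorm, Real.sq_sqrt (by positivity), EuclideanSpace.real_norm_sq_eq,
    Finset.sum_mul]
  refine Finset.sum_le_sum fun i _ => ?_
  have := sq_dotProduct_le (A i) v.ofLp
  rw [dotProduct_self_eq_norm_sq v] at this
  refine this.trans_eq ?_
  simp only [dotProduct, sq]

/-- The estimation error is controlled by the self-normalized noise terms. -/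
theorem opNorm_le_of_gram_mul_eq {d n : ℕ} {γ : ℝ} (hγ : 0 < γ) (z : ℕ → Fin d → ℝ)
    (w : ℕ → Fin n → ℝ) (t : ℕ) {Δ θ : Mat d n}
    (h : gram γ z t * Δ = ∑ s ∈ Finset.range t, Matrix.vecMulVec (z s) (w (s + 1)) - γ • θ)
    {lam R : ℝ} (hlam : 0 < lam)
    (hG : ∀ u : Fin d → ℝ, lam * (u ⬝ᵥ u) ≤ u ⬝ᵥ (gram γ z t).mulVec u)
    (hR : ∀ j, cross z (fun s => w s j) t ⬝ᵥ (gram γ z t)⁻¹.mulVec (cross z (fun s => w s j) t)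
      ≤ R) :
    opNorm Δ ≤ 1 / √lam * (√γ * frobNorm θ + √(n * R)) := by
  have hC : 0 ≤ √γ * frobNorm θ + √(n * R) :=
    add_nonneg (mul_nonneg (Real.sqrt_nonneg _) (frobNorm_nonneg θ)) (Real.sqrt_nonneg _)
  refine ContinuousLinearMap.opNorm_le_bound _ (by positivity) fun v => ?_
  set u : Vec d := WithLp.toLp 2 (Δ.mulVec v.ofLp) with hu
  have hval : (LinearMap.toContinuousLinearMap (Matrix.toEuclideanLin Δ)) v = u := rfl
  rw [hval]
  -- The energy of u = Δ v. Each term of the error equation, tested against `u`, is at most √q times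
  -- a constant times ‖v‖, so √q itself is bounded, and λ ‖u‖² ≤ q finishes.
  set q := u.ofLp ⬝ᵥ (gram γ z t).mulVec u.ofLp with hq
  have hlamq : lam * ‖u‖ ^ 2 ≤ q := by rw [← dotProduct_self_eq_norm_sq]; exact hG _
  have hγq : γ * ‖u‖ ^ 2 ≤ q := by
    rw [hq, dotProduct_gram_mulVec, dotProduct_self_eq_norm_sq]
    exact le_add_of_nonneg_right (Finset.sum_nonneg fun s _ => sq_nonneg _)
  have hq0 : 0 ≤ q := le_trans (by positivity) hlamq
  have hcross : (∑ s ∈ Finset.range t, Matrix.vecMulVec (z s) (w (s + 1))).mulVec v.ofLp =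
      ∑ j, v.ofLp j • cross z (fun s => w s j) t := by
    simp only [Matrix.sum_mulVec, Matrix.vecMulVec_mulVec, cross, Finset.smul_sum]
    rw [Finset.sum_comm]
    refine Finset.sum_congr rfl fun s _ => ?_
    rw [op_smul_eq_smul]
    simp only [dotProduct, Finset.sum_smul, smul_smul]
    exact Finset.sum_congr rfl fun j _ => by rw [mul_comm]
  have hqeq : q = ∑ j, v.ofLp j * (u.ofLp ⬝ᵥ cross z (fun s => w s j) t) -
      γ * (u.ofLp ⬝ᵥ θ.mulVec v.ofLp) := by
    have e : (gram γ z t).mulVec u.ofLp = ∑ j, v.ofLp j • cross z (fun s => w s j) t -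
        γ • θ.mulVec v.ofLp := by
      rw [hu, ← hcross, ← Matrix.smul_mulVec, ← Matrix.sub_mulVec, ← h, Matrix.mulVec_mulVec]
    rw [hq, e, dotProduct_sub, dotProduct_sum, dotProduct_smul]
    simp only [dotProduct_smul, smul_eq_mul]
  have hS : ∀ j, |u.ofLp ⬝ᵥ cross z (fun s => w s j) t| ≤ √q * √R := fun j =>
    (dotProduct_le_sqrt_mul_sqrt (posDef_gram hγ z t) _ _).trans
      (mul_le_mul_of_nonneg_left (Real.sqrt_le_sqrt (hR j)) (Real.sqrt_nonneg _))
  -- The noise coordinates are bounded separately; adding them up in the direction `v` costs the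
  -- factor √n.
  have hsum : ∑ j, |v.ofLp j| ≤ √n * ‖v‖ := by
    refine le_of_sq_le_sq ?_ (by positivity)
    have := sq_sum_le_card_mul_sum_sq (s := Finset.univ) (f := fun j => |v.ofLp j|)
    rw [mul_pow, Real.sq_sqrt (Nat.cast_nonneg n), EuclideanSpace.real_norm_sq_eq]
    simpa using this
  have hfirst : ∑ j, v.ofLp j * (u.ofLp ⬝ᵥ cross z (fun s => w s j) t) ≤
      √q * (√(n * R) * ‖v‖) := by
    calc _ ≤ ∑ j, |v.ofLp j| * (√q * √R) := Finset.sum_le_sum fun j _ =>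
          (le_abs_self _).trans (by rw [abs_mul]; gcongr; exact hS j)
      _ = (∑ j, |v.ofLp j|) * (√q * √R) := by rw [Finset.sum_mul]
      _ ≤ (√n * ‖v‖) * (√q * √R) := by gcongr
      _ = _ := by rw [Real.sqrt_mul (Nat.cast_nonneg n)]; ring
  -- The regulariser alone gives this, which is why the bias term carries √γ rather than γ / √λ.
  have hγu : √γ * ‖u‖ ≤ √q := by
    rw [← Real.sqrt_sq (norm_nonneg u), ← Real.sqrt_mul hγ.le]
    exact Real.sqrt_le_sqrt hγq
  have hsecond : -(γ * (u.ofLp ⬝ᵥ θ.mulVec v.ofLp)) ≤ √q * (√γ * frobNorm θ * ‖v‖) := by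
    have h1 : |u.ofLp ⬝ᵥ θ.mulVec v.ofLp| ≤ ‖u‖ * (frobNorm θ * ‖v‖) := by
      have := abs_real_inner_le_norm u (WithLp.toLp 2 (θ.mulVec v.ofLp) : Vec d)
      rw [inner_eq_ofLp_dotProduct] at this
      exact this.trans (by gcongr; exact norm_mulVec_le_frobNorm θ v)
    calc _ = γ * -(u.ofLp ⬝ᵥ θ.mulVec v.ofLp) := by ring
      _ ≤ γ * (‖u‖ * (frobNorm θ * ‖v‖)) := by
        gcongr
        exact (neg_le_abs _).trans h1
      _ = (√γ * ‖u‖) * (√γ * frobNorm θ * ‖v‖) := by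
        nth_rewrite 1 [← Real.mul_self_sqrt hγ.le]
        ring
      _ ≤ _ := by
        have := frobNorm_nonneg θ
        gcongr
  have hmain : √q ≤ (√γ * frobNorm θ + √(n * R)) * ‖v‖ := by
    rcases (Real.sqrt_nonneg q).eq_or_lt with h0 | h0
    · rw [← h0]; positivity
    · refine le_of_mul_le_mul_left ?_ h0
      rw [Real.mul_self_sqrt hq0]
      linarith
  have hlamu : √lam * ‖u‖ ≤ √q := by
    rw [← Real.sqrt_sq (norm_nonneg u), ← Real.sqrt_mul hlam.le]
    exact Real.sqrt_le_sqrt hlamq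
  rw [mul_assoc, one_div, inv_mul_eq_div, le_div_iff₀ (Real.sqrt_pos.2 hlam), mul_comm]
  exact hlamu.trans hmain

end LinearAlgebra

end SysId

namespace SysId

/-! ### Normal equations and measurability of the estimator. -/

namespace ClosedLoop

variable {n m d q : ℕ} (L : ClosedLoop n m d q)

theorem tmul_apply (θ : Mat d n) (z : Vec d) (j : Fin n) :
    (tmul θ z).ofLp j = ∑ i, θ i j * z.ofLp i := rfl

theorem frobNorm_sq (θ : Mat d n) : frobNorm θ ^ 2 = ∑ i, ∑ j, θ i j ^ 2 :=
  Real.sq_sqrt (Finset.sum_nonneg fun _ _ => Finset.sum_nonneg fun _ _ => sq_nonneg _)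

theorem tmul_add_smul (θ D : Mat d n) (τ : ℝ) (z : Vec d) :
    tmul (θ + τ • D) z = tmul θ z + τ • tmul D z := by
  ext j
  simp only [tmul_apply, PiLp.add_apply, PiLp.smul_apply, Matrix.add_apply, Matrix.smul_apply,
    smul_eq_mul, add_mul, Finset.sum_add_distrib, Finset.mul_sum, mul_assoc]

/-- The normal equations of regularised least squares. -/
theorem normal_equations {ι : Type*} (s : Finset ι) (z : ι → Vec d) (r : ι → Vec n) {γ : ℝ}
    {θ : Mat d n}
    (hmin : ∀ θ', ∑ k ∈ s, ‖r k - tmul θ (z k)‖ ^ 2 + γ * frobNorm θ ^ 2 ≤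
      ∑ k ∈ s, ‖r k - tmul θ' (z k)‖ ^ 2 + γ * frobNorm θ' ^ 2) :
    (γ • 1 + ∑ k ∈ s, Matrix.vecMulVec (z k).ofLp (z k).ofLp) * θ =
      ∑ k ∈ s, Matrix.vecMulVec (z k).ofLp (r k).ofLp := by
  have hlin : ∀ D : Mat d n, ∑ k ∈ s, inner ℝ (r k - tmul θ (z k)) (tmul D (z k)) =
      γ * ∑ i, ∑ j, θ i j * D i j := by
    intro D
    -- First variation without derivatives: a nonnegative quadratic in τ with zero constant term has
    -- nonpositive discriminant, so its linear coefficient vanishes.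
    have hquad : ∀ τ : ℝ, 0 ≤ (∑ k ∈ s, ‖tmul D (z k)‖ ^ 2 + γ * frobNorm D ^ 2) * (τ * τ) +
        (2 * (γ * ∑ i, ∑ j, θ i j * D i j -
          ∑ k ∈ s, inner ℝ (r k - tmul θ (z k)) (tmul D (z k)))) * τ + 0 := by
      intro τ
      have h1 : ∀ k, ‖r k - tmul (θ + τ • D) (z k)‖ ^ 2 = ‖r k - tmul θ (z k)‖ ^ 2 -
          2 * τ * inner ℝ (r k - tmul θ (z k)) (tmul D (z k)) + τ * τ * ‖tmul D (z k)‖ ^ 2 := by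
        intro k
        rw [tmul_add_smul, ← sub_sub, norm_sub_sq_real, inner_smul_right, norm_smul, mul_pow,
          Real.norm_eq_abs, sq_abs]
        ring
      have h2 : frobNorm (θ + τ • D) ^ 2 = frobNorm θ ^ 2 + 2 * τ * ∑ i, ∑ j, θ i j * D i j +
          τ * τ * frobNorm D ^ 2 := by
        simp only [frobNorm_sq, Finset.mul_sum, ← Finset.sum_add_distrib, Matrix.add_apply,
          Matrix.smul_apply, smul_eq_mul]
        refine Finset.sum_congr rfl fun i _ => Finset.sum_congr rfl fun j _ => ?_
        ring
      have h := hmin (θ + τ • D)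
      simp only [h1, h2, Finset.sum_add_distrib, Finset.sum_sub_distrib, ← Finset.mul_sum] at h
      linarith
    have h := discrim_le_zero hquad
    rw [discrim, mul_zero, sub_zero] at h
    have h' := pow_eq_zero_iff (two_ne_zero) |>.1 (le_antisymm h (sq_nonneg _))
    linarith
  ext i j
  have h := hlin (Matrix.single i j 1)
  have hr : ∑ a, ∑ b, θ a b * Matrix.single i j (1 : ℝ) a b = θ i j := by
    rw [Finset.sum_eq_single i, Finset.sum_eq_single j]
    · simp
    · intro b _ hb; simp [Matrix.single, Ne.symm hb]
    · simp
    · intro a _ ha; simp [Matrix.single, Ne.symm ha]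
    · simp
  have ht : ∀ k, inner ℝ (r k - tmul θ (z k)) (tmul (Matrix.single i j (1 : ℝ)) (z k)) =
      (z k).ofLp i * ((r k).ofLp j - ∑ a, θ a j * (z k).ofLp a) := by
    intro k
    have e : tmul (Matrix.single i j (1 : ℝ)) (z k) = EuclideanSpace.single j ((z k).ofLp i) := by
      ext b
      rw [tmul_apply, Finset.sum_eq_single i]
      · by_cases hb : j = b
        · subst hb; simp
        · simp [Matrix.single, hb, Ne.symm hb]
      · intro a _ ha; simp [Matrix.single, Ne.symm ha]
      · simp
    rw [e, EuclideanSpace.inner_single_right]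
    simp [tmul_apply]
  simp only [ht, hr, mul_sub, Finset.sum_sub_distrib] at h
  rw [Matrix.add_mul, Matrix.add_apply, Matrix.smul_mul, Matrix.one_mul, Matrix.smul_apply,
    smul_eq_mul, Matrix.sum_mul, Matrix.sum_apply, Matrix.sum_apply, ← h, sub_add_eq_add_sub,
    sub_eq_iff_eq_add]
  congr 1
  refine Finset.sum_congr rfl fun k _ => ?_
  simp only [Matrix.mul_apply, Matrix.vecMulVec_apply, Finset.mul_sum]
  exact Finset.sum_congr rfl fun a _ => by ring

/-- The estimate is defined by `Classical.epsilon`; this identity is the only property of it used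
for measurability and for the error equation. -/
theorem gram_mul_rls {t : ℕ} (ht : t ≠ 0) (h : Fin (t + 1) → L.stateSpace × L.controlSpace) :
    (L.γ • 1 + ∑ s : Fin t, Matrix.vecMulVec (L.ψ (h s.castSucc)).ofLp
      (L.ψ (h s.castSucc)).ofLp) * L.rls t h =
    ∑ s : Fin t, Matrix.vecMulVec (L.ψ (h s.castSucc)).ofLp
      (((h s.succ).1 : Vec n) - L.f (h s.castSucc)).ofLp := by
  refine normal_equations Finset.univ (fun s : Fin t => L.ψ (h s.castSucc))
    (fun s => ((h s.succ).1 : Vec n) - L.f (h s.castSucc)) fun θ' => ?_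
  have := L.rls_isMin t ht h θ'
  simpa only [rlsCost, sub_right_comm] using this

theorem posDef_sum_vecMulVec {t : ℕ} {γ : ℝ} (hγ : 0 < γ) (z : Fin t → Fin d → ℝ) :
    (γ • (1 : Mat d d) + ∑ s : Fin t, Matrix.vecMulVec (z s) (z s)).PosDef := by
  refine (Matrix.PosDef.one.smul hγ).add_posSemidef (Matrix.posSemidef_sum _ fun s _ => ?_)
  simpa using Matrix.posSemidef_vecMulVec_self_star (z s)

theorem measurable_mat_mul {α : Type*} [MeasurableSpace α] {k l r : ℕ} {A : α → Mat k l}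
    {B : α → Mat l r} (hA : Measurable A) (hB : Measurable B) : Measurable fun x => A x * B x := by
  have hA' : ∀ i j, Measurable fun x => A x i j := fun i j =>
    (measurable_pi_apply j).comp ((measurable_pi_apply i).comp hA)
  have hB' : ∀ i j, Measurable fun x => B x i j := fun i j =>
    (measurable_pi_apply j).comp ((measurable_pi_apply i).comp hB)
  refine measurable_pi_lambda _ fun i => measurable_pi_lambda _ fun j => ?_
  simp only [Matrix.mul_apply]
  fun_prop

theorem measurable_sum_vecMulVec {α ι : Type*} [MeasurableSpace α] {k l : ℕ} (s : Finset ι)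
    {u : ι → α → Fin k → ℝ} {v : ι → α → Fin l → ℝ} (hu : ∀ i, Measurable (u i))
    (hv : ∀ i, Measurable (v i)) :
    Measurable fun x => (∑ i ∈ s, Matrix.vecMulVec (u i x) (v i x) : Mat k l) := by
  refine measurable_pi_lambda _ fun i => measurable_pi_lambda _ fun j => ?_
  simp only [Matrix.sum_apply, Matrix.vecMulVec_apply]
  fun_prop

/-- A choice of minimisers need not be measurable. Here the regularised Gramian is invertible, so
the choice agrees with an explicit measurable formula. -/
theorem measurable_rls (hL : L.MeasurableMaps) (t : ℕ) : Measurable (L.rls t) := by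
  obtain ⟨hf, hψ, -⟩ := hL
  rcases eq_or_ne t 0 with rfl | ht
  · have : L.rls 0 = fun _ => L.ϑ0 := by funext h; simp [rls]
    rw [this]
    exact measurable_const
  have heq : L.rls t = fun h => (L.γ • 1 + ∑ s : Fin t, Matrix.vecMulVec
      (L.ψ (h s.castSucc)).ofLp (L.ψ (h s.castSucc)).ofLp)⁻¹ *
      ∑ s : Fin t, Matrix.vecMulVec (L.ψ (h s.castSucc)).ofLp
        (((h s.succ).1 : Vec n) - L.f (h s.castSucc)).ofLp := by
    funext h
    rw [← L.gram_mul_rls ht h, ← Matrix.mul_assoc, Matrix.nonsing_inv_mul, Matrix.one_mul]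
    exact (posDef_sum_vecMulVec L.γ_pos fun s : Fin t =>
      (L.ψ (h s.castSucc)).ofLp).det_pos.ne'.isUnit
  rw [heq]
  have hz : ∀ s : Fin t, Measurable fun h : Fin (t + 1) → L.stateSpace × L.controlSpace =>
      (L.ψ (h s.castSucc)).ofLp := fun s => by fun_prop
  have hr : ∀ s : Fin t, Measurable fun h : Fin (t + 1) → L.stateSpace × L.controlSpace =>
      (((h s.succ).1 : Vec n) - L.f (h s.castSucc)).ofLp := fun s => by fun_prop
  have hG := measurable_sum_vecMulVec Finset.univ hz hz
  refine measurable_mat_mul (measurable_matrix_inv.comp ?_)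
    (measurable_sum_vecMulVec Finset.univ hz hr)
  refine measurable_pi_lambda _ fun i => measurable_pi_lambda _ fun j => ?_
  exact measurable_const.add ((measurable_pi_apply j).comp ((measurable_pi_apply i).comp hG))

theorem measurable_tmul (θ : Mat d n) : Measurable (tmul θ) :=
  (LinearMap.continuous_of_finiteDimensional
    (Matrix.toEuclideanLin θ.transpose)).measurable

theorem measurable_g (hL : L.MeasurableMaps) :
    Measurable fun x : (L.stateSpace × L.controlSpace) × L.procSpace => L.g x.1.1 x.1.2 x.2 := by
  obtain ⟨hf, hψ, -⟩ := hL
  refine Measurable.subtype_mk ?_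
  have := measurable_tmul L.θs
  fun_prop

/-- The next state-control pair, as a function of the current pair, the current estimate and the
new noise pair. -/
def step (x : (L.stateSpace × L.controlSpace) × Mat d n) (y : L.procSpace × L.explSpace) :
    L.stateSpace × L.controlSpace :=
  (L.g x.1.1 x.1.2 y.1, L.α (L.g x.1.1 x.1.2 y.1, y.2, x.2))

theorem measurable_step (hL : L.MeasurableMaps) :
    Measurable fun x : ((L.stateSpace × L.controlSpace) × Mat d n) × (L.procSpace × L.explSpace) =>
      L.step x.1 x.2 := by
  have hg : Measurable fun x : ((L.stateSpace × L.controlSpace) × Mat d n) ×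
      (L.procSpace × L.explSpace) => L.g x.1.1.1 x.1.1.2 x.2.1 :=
    (L.measurable_g hL).comp (f := fun x : ((L.stateSpace × L.controlSpace) × Mat d n) ×
      (L.procSpace × L.explSpace) => (x.1.1, x.2.1)) (by fun_prop)
  have hα := hL.2.2
  exact hg.prodMk (hα.comp (hg.prodMk (by fun_prop)))

/-! ### The noise filtration and independence of the next noise pair. -/

section Random

variable {Ω : Type*} {mΩ : MeasurableSpace Ω} {W : ℕ → Ω → L.procSpace} {S : ℕ → Ω → L.explSpace}

/-- The filtration generated by `W 1, …, W t` and `S 0, …, S t`. -/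
def noiseFiltration (hW : ∀ t, Measurable (W (t + 1))) (hS : ∀ t, Measurable (S t)) :
    Filtration ℕ mΩ where
  -- `S t` is included at time `t` because U(t) uses it; the shift leaves out `W 0`, about which
  -- nothing is assumed.
  seq t := (⨆ i ∈ Iio t, MeasurableSpace.comap (W (i + 1)) inferInstance) ⊔
    (⨆ i ∈ Iic t, MeasurableSpace.comap (S i) inferInstance)
  mono' _ _ hst := sup_le_sup (biSup_mono fun _ hi => lt_of_lt_of_le hi hst)
    (biSup_mono fun _ hi => le_trans hi hst)
  le' _ := sup_le (iSup₂_le fun i _ => (hW i).comap_le) (iSup₂_le fun i _ => (hS i).comap_le)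

theorem measurable_noiseFiltration_W (hW : ∀ t, Measurable (W (t + 1)))
    (hS : ∀ t, Measurable (S t)) (t : ℕ) :
    Measurable[L.noiseFiltration hW hS (t + 1)] (W (t + 1)) := by
  refine measurable_iff_comap_le.2 (le_trans ?_ le_sup_left)
  exact le_biSup (fun i => MeasurableSpace.comap (W (i + 1)) inferInstance) (Nat.lt_succ_self t)

theorem measurable_noiseFiltration_S (hW : ∀ t, Measurable (W (t + 1)))
    (hS : ∀ t, Measurable (S t)) (t : ℕ) : Measurable[L.noiseFiltration hW hS t] (S t) := by
  refine measurable_iff_comap_le.2 (le_trans ?_ le_sup_right)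
  exact le_biSup (fun i => MeasurableSpace.comap (S i) inferInstance) (le_refl t)

/-- Strong induction, because the next control depends through the estimate on the whole past. -/
theorem measurable_traj (hL : L.MeasurableMaps) (hW : ∀ t, Measurable (W (t + 1)))
    (hS : ∀ t, Measurable (S t)) (x0 : L.stateSpace) (t : ℕ) :
    Measurable[L.noiseFiltration hW hS t]
      fun ω => L.traj x0 (fun i => W i ω) (fun i => S i ω) t := by
  induction t using Nat.strong_induction_on with
  | _ t ih =>
    rcases t with _ | t
    · simp only [traj]
      have := L.measurable_noiseFiltration_S hW hS 0
      exact measurable_const.prodMk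
        (hL.2.2.comp (measurable_const.prodMk (this.prodMk measurable_const)))
    · have hpast : ∀ i ≤ t, Measurable[L.noiseFiltration hW hS (t + 1)]
          fun ω => L.traj x0 (fun i => W i ω) (fun i => S i ω) i := fun i hi =>
        (ih i (by omega)).mono ((L.noiseFiltration hW hS).mono (by omega)) le_rfl
      have hest : Measurable[L.noiseFiltration hW hS (t + 1)]
          fun ω => L.estimate x0 (fun i => W i ω) (fun i => S i ω) t :=
        (L.measurable_rls hL t).comp
          (@measurable_pi_lambda _ _ _ (L.noiseFiltration hW hS (t + 1)) _ _ fun i =>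
            hpast i.1 (by have := i.2; omega))
      have := (L.measurable_step hL).comp
        (((hpast t le_rfl).prodMk hest).prodMk ((L.measurable_noiseFiltration_W hW hS t).prodMk
          (L.measurable_noiseFiltration_S hW hS (t + 1))))
      simp only [traj_succ]
      exact this

theorem measurable_estimate (hL : L.MeasurableMaps) (hW : ∀ t, Measurable (W (t + 1)))
    (hS : ∀ t, Measurable (S t)) (x0 : L.stateSpace) (t : ℕ) :
    Measurable[L.noiseFiltration hW hS t]
      fun ω => L.estimate x0 (fun i => W i ω) (fun i => S i ω) t :=
  (L.measurable_rls hL t).comp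
    (@measurable_pi_lambda _ _ _ (L.noiseFiltration hW hS t) _ _ fun i =>
      (L.measurable_traj hL hW hS x0 i.1).mono
        ((L.noiseFiltration hW hS).mono (Nat.lt_succ_iff.1 i.2)) le_rfl)

variable {P : Measure Ω} [IsProbabilityMeasure P] {μw : Measure L.procSpace}
  {μs : Measure L.explSpace} {σw : ℝ≥0}

/-- Each sequence has its past independent of its next value, and the sequences are independent of
each other; `indep_sup_sup` merges these facts. -/
theorem indep_noiseFiltration (hN : L.NoiseAssumption P W S μw μs σw)
    (hW : ∀ t, Measurable (W (t + 1))) (hS : ∀ t, Measurable (S t)) (t : ℕ) :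
    Indep (L.noiseFiltration hW hS t)
      (MeasurableSpace.comap (fun ω => (W (t + 1) ω, S (t + 1) ω)) inferInstance) P := by
  have hcomap : MeasurableSpace.comap (fun ω => (W (t + 1) ω, S (t + 1) ω)) inferInstance =
      MeasurableSpace.comap (W (t + 1)) inferInstance ⊔
        MeasurableSpace.comap (S (t + 1)) inferInstance := MeasurableSpace.comap_prodMk _ _
  rw [hcomap]
  have hWle : ∀ i, MeasurableSpace.comap (W (i + 1)) inferInstance ≤
      MeasurableSpace.comap (fun ω t => W (t + 1) ω) inferInstance := fun i => by
    refine measurable_iff_comap_le.1 ?_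
    exact (measurable_pi_apply i).comp (comap_measurable (fun ω t => W (t + 1) ω))
  have hSle : ∀ i, MeasurableSpace.comap (S i) inferInstance ≤
      MeasurableSpace.comap (fun ω t => S t ω) inferInstance := fun i => by
    refine measurable_iff_comap_le.1 ?_
    exact (measurable_pi_apply i).comp (comap_measurable (fun ω t => S t ω))
  refine indep_sup_sup (iSup₂_le fun i _ => (hW i).comap_le) (hW t).comap_le
    (iSup₂_le fun i _ => (hS i).comap_le) (hS (t + 1)).comap_le ?_ ?_ ?_
  · have := indep_iSup_of_disjoint (fun i => (hW i).comap_le)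
      ((iIndepFun_iff_iIndep _ _ _).1 hN.indep_W) (S := Iio t) (T := {t})
      (by simp)
    simpa using this
  · have := indep_iSup_of_disjoint (fun i => (hS i).comap_le)
      ((iIndepFun_iff_iIndep _ _ _).1 hN.indep_S) (S := Iic t) (T := {t + 1})
      (by simp)
    simpa using this
  · exact indep_of_indep_of_le_left (indep_of_indep_of_le_right
      ((IndepFun_iff_Indep _ _ _).1 hN.indep_W_S)
      (sup_le (iSup₂_le fun i _ => hSle i) (hSle _)))
      (sup_le (iSup₂_le fun i _ => hWle i) (hWle t))

theorem map_noise_pair (hN : L.NoiseAssumption P W S μw μs σw) (t : ℕ) :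
    P.map (fun ω => (W (t + 1) ω, S (t + 1) ω)) = μw.prod μs := by
  have hW := hN.measurable_W (t + 1) (by omega)
  have hS := hN.measurable_S (t + 1)
  have hI : IndepFun (W (t + 1)) (S (t + 1)) P :=
    hN.indep_W_S.comp (measurable_pi_apply t) (measurable_pi_apply (t + 1))
  rw [(indepFun_iff_map_prod_eq_prod_map_map hW.aemeasurable hS.aemeasurable).1 hI,
    hN.law_W (t + 1) (by omega), hN.law_S]

end Random

end ClosedLoop

end SysId

/-! ### Noise, state and regressor bounds. -/

namespace SysId

/-- A countable union bound with weights `6 / (π² t²)`. -/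
theorem measure_iUnion_le_of_le_sq {Ω : Type*} {mΩ : MeasurableSpace Ω} {P : Measure Ω}
    {s : ℕ → Set Ω} {η : ℝ} (hη : 0 ≤ η)
    (h : ∀ t, P (s t) ≤ ENNReal.ofReal (η * (6 / Real.pi ^ 2 * (1 / (t : ℝ) ^ 2)))) :
    P (⋃ t, s t) ≤ ENNReal.ofReal η := by
  -- The Basel sum. At `t = 0` the weight is 1 / 0 = 0, so `s 0` is forced to be null; in the
  -- applications it is empty.
  have hsum := (hasSum_zeta_two.mul_left (6 / Real.pi ^ 2)).mul_left η
  have hval : η * (6 / Real.pi ^ 2 * (Real.pi ^ 2 / 6)) = η := by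
    have := Real.pi_pos
    field_simp
  rw [hval] at hsum
  refine (measure_iUnion_le s).trans ((ENNReal.tsum_le_tsum h).trans_eq ?_)
  rw [← ENNReal.ofReal_tsum_of_nonneg (fun t => by positivity) hsum.summable, hsum.tsum_eq]

/-- Norm tail bound of a sub-Gaussian vector. -/
theorem measure_lt_norm_le {Ω : Type*} {mΩ : MeasurableSpace Ω} {P : Measure Ω}
    [IsProbabilityMeasure P] {n : ℕ} (hn : 0 < n) {X : Ω → Vec n} {σ : ℝ≥0}
    (hX : ∀ ζ : Vec n, ‖ζ‖ = 1 → HasSubgaussianMGF (fun ω => inner ℝ ζ (X ω)) (σ ^ 2) P)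
    {k : ℝ} (hk : 1 ≤ k) :
    P {ω | σ * √(2 * n * Real.log k) < ‖X ω‖} ≤ ENNReal.ofReal (2 * n / k) := by
  have hn' : (0 : ℝ) < n := by exact_mod_cast hn
  have hlog : 0 ≤ Real.log k := Real.log_nonneg hk
  have hcoord : ∀ (x : Vec n) (j : Fin n), inner ℝ (EuclideanSpace.single j (1 : ℝ)) x = x.ofLp j :=
    fun x j => by rw [EuclideanSpace.inner_single_left]; simp
  have hcoord' : ∀ (x : Vec n) (j : Fin n),
      inner ℝ (-EuclideanSpace.single j (1 : ℝ)) x = -x.ofLp j :=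
    fun x j => by rw [inner_neg_left, hcoord]
  have hsub : ∀ j, HasSubgaussianMGF (fun ω => (X ω).ofLp j) (σ ^ 2) P := fun j => by
    simpa only [hcoord] using hX (EuclideanSpace.single j (1 : ℝ)) (by simp)
  have hsub' : ∀ j, HasSubgaussianMGF (fun ω => -(X ω).ofLp j) (σ ^ 2) P := fun j => by
    simpa only [hcoord'] using hX (-EuclideanSpace.single j (1 : ℝ)) (by simp)
  rcases eq_or_ne σ 0 with rfl | hσ
  · have h0 : ∀ᵐ ω ∂P, ∀ j, (X ω).ofLp j = 0 := ae_all_iff.2 fun j =>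
      HasSubgaussianMGF.ae_eq_zero_of_hasSubgaussianMGF_zero (by simpa using hsub j)
    refine le_trans (le_of_eq (measure_mono_null ?_ h0)) zero_le
    intro ω hω h
    have : X ω = 0 := by ext j; exact h j
    simp [this] at hω
  have hσ' : (0 : ℝ) < σ := by positivity
  -- A threshold per coordinate: each of the 2n one-sided events has probability at most 1/k, and
  -- outside them the norm is at most √n ρ.
  set ρ := σ * √(2 * Real.log k) with hρ
  have hρ0 : 0 ≤ ρ := by positivity
  have hexp : Real.exp (-ρ ^ 2 / (2 * (σ ^ 2 : ℝ≥0))) = 1 / k := by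
    have : -ρ ^ 2 / (2 * ((σ ^ 2 : ℝ≥0) : ℝ)) = -Real.log k := by
      rw [hρ, mul_pow, Real.sq_sqrt (by positivity)]
      push_cast
      field_simp
    rw [this, Real.exp_neg, Real.exp_log (by linarith), one_div]
  have hone : ∀ Y : Ω → ℝ, HasSubgaussianMGF Y (σ ^ 2) P →
      P {ω | ρ ≤ Y ω} ≤ ENNReal.ofReal (1 / k) := by
    intro Y hY
    have := hY.measure_ge_le hρ0
    rw [hexp] at this
    rw [← ofReal_measureReal]
    exact ENNReal.ofReal_le_ofReal this
  have hincl : {ω | σ * √(2 * n * Real.log k) < ‖X ω‖} ⊆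
      ⋃ j ∈ (Finset.univ : Finset (Fin n)),
        ({ω | ρ ≤ (X ω).ofLp j} ∪ {ω | ρ ≤ -(X ω).ofLp j}) := by
    intro ω hω
    by_contra hcon
    simp only [Finset.mem_univ, iUnion_true, mem_iUnion, mem_union, mem_ofPred_eq, not_exists,
      not_or, not_le] at hcon
    refine absurd (show σ * √(2 * n * Real.log k) < ‖X ω‖ from hω) (not_lt.2 ?_)
    refine le_of_sq_le_sq ?_ (by positivity)
    rw [EuclideanSpace.real_norm_sq_eq]
    calc ∑ j, (X ω).ofLp j ^ 2 ≤ ∑ _j : Fin n, ρ ^ 2 := Finset.sum_le_sum fun j _ => by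
          have := hcon j
          exact sq_le_sq' (by linarith) (by linarith)
      _ = (σ * √(2 * n * Real.log k)) ^ 2 := by
          rw [hρ, mul_pow, mul_pow, Real.sq_sqrt (by positivity), Real.sq_sqrt (by positivity)]
          simp
          ring
  refine (measure_mono hincl).trans ((measure_biUnion_finset_le _ _).trans ?_)
  calc ∑ j : Fin n, P ({ω | ρ ≤ (X ω).ofLp j} ∪ {ω | ρ ≤ -(X ω).ofLp j})
      ≤ ∑ _j : Fin n, ENNReal.ofReal (2 * (1 / k)) := Finset.sum_le_sum fun j _ => by
        refine (measure_union_le _ _).trans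
          ((add_le_add (hone _ (hsub j)) (hone _ (hsub' j))).trans_eq ?_)
        rw [← ENNReal.ofReal_add (by positivity) (by positivity), two_mul]
    _ = ENNReal.ofReal (2 * n / k) := by
        rw [Finset.sum_const, Finset.card_univ, Fintype.card_fin, nsmul_eq_mul,
          ← ENNReal.ofReal_natCast, ← ENNReal.ofReal_mul hn'.le]
        congr 1
        ring

namespace ClosedLoop

theorem wBar_arg_one_le {n : ℕ} (hn : 0 < n) {δ : ℝ} (hδ : 0 < δ) (hδ1 : δ < 1) {t : ℕ}
    (ht : 1 ≤ t) : 1 ≤ n * Real.pi ^ 2 * (t : ℝ) ^ 2 / (3 * δ) := by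
  have hn' : (1 : ℝ) ≤ n := by exact_mod_cast hn
  have ht' : (1 : ℝ) ≤ t := by exact_mod_cast ht
  have hpi := Real.pi_gt_three
  rw [le_div_iff₀ (by positivity), one_mul]
  calc 3 * δ ≤ 1 * 3 ^ 2 * 1 ^ 2 := by linarith
    _ ≤ n * Real.pi ^ 2 * (t : ℝ) ^ 2 := by gcongr

theorem coe_wBar (n : ℕ) (σw : ℝ≥0) {t : ℕ} (ht : t ≠ 0) (δ : ℝ) :
    (wBar n σw t δ : ℝ) =
      σw * √(2 * n * Real.log (n * Real.pi ^ 2 * (t : ℝ) ^ 2 / (3 * δ))) := by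
  rw [wBar, if_neg ht, NNReal.coe_mul, Real.coe_toNNReal _ (Real.sqrt_nonneg _)]

/-- Small arguments of the logarithm do no harm: `√` is zero on negative reals and monotone
throughout. -/
theorem monotone_wBar {n : ℕ} (hn : 0 < n) (σw : ℝ≥0) {δ : ℝ} (hδ : 0 < δ) :
    Monotone fun t => wBar n σw t δ := by
  intro s t hst
  rcases Nat.eq_zero_or_pos s with rfl | hs
  · simp [wBar]
  have hn' : (0 : ℝ) < n := by exact_mod_cast hn
  have hs' : (0 : ℝ) < s := by exact_mod_cast hs
  rw [← NNReal.coe_le_coe]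
  change (wBar n σw s δ : ℝ) ≤ wBar n σw t δ
  rw [coe_wBar n σw (by omega), coe_wBar n σw (by omega)]
  have := Real.pi_pos
  gcongr

variable {n m d q : ℕ} (L : ClosedLoop n m d q) (B : Growth)

/-- With high probability, the process noise obeys its bound at all times. -/
theorem measure_exists_wBar_lt_le (hn : 0 < n) {Ω : Type*} [MeasurableSpace Ω] {P : Measure Ω}
    [IsProbabilityMeasure P] {W : ℕ → Ω → L.procSpace} {S : ℕ → Ω → L.explSpace}
    {μw : Measure L.procSpace} {μs : Measure L.explSpace} {σw : ℝ≥0}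
    (hN : L.NoiseAssumption P W S μw μs σw) {δ : ℝ} (hδ : 0 < δ) (hδ1 : δ < 1) :
    P {ω | ∃ t, 1 ≤ t ∧ wBar n σw t δ < ‖(W t ω : Vec n)‖₊} ≤ ENNReal.ofReal δ := by
  have hU : {ω | ∃ t, 1 ≤ t ∧ wBar n σw t δ < ‖(W t ω : Vec n)‖₊} =
      ⋃ t, {ω | 1 ≤ t ∧ wBar n σw t δ < ‖(W t ω : Vec n)‖₊} := by ext; simp
  rw [hU]
  refine measure_iUnion_le_of_le_sq hδ.le fun t => ?_
  rcases Nat.eq_zero_or_pos t with rfl | ht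
  · simp
  have hn' : (0 : ℝ) < n := by exact_mod_cast hn
  have ht' : (0 : ℝ) < t := by exact_mod_cast ht
  have hpi := Real.pi_pos
  have h := measure_lt_norm_le hn (hN.subGaussian_W t ht) (wBar_arg_one_le hn hδ hδ1 ht)
  refine le_trans (measure_mono ?_) (h.trans_eq ?_)
  · rintro ω ⟨-, hω⟩
    rw [← NNReal.coe_lt_coe, coe_wBar n σw (by omega)] at hω
    exact hω
  -- With k = n π² t² / (3δ), the tail 2n / k is δ times the Basel weight 6 / (π² t²).
  · congr 1
    field_simp
    norm_num

theorem monotone_xBar (hn : 0 < n) (hB : L.StateBound B) (σw : ℝ≥0) {δ : ℝ} (hδ : 0 < δ)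
    (x0 : L.stateSpace) : Monotone fun t => L.xBar B σw t δ x0 := by
  intro s t hst
  have h1 := hB.χ₁_mem.1.1.2.1.monotone
  have h3 := hB.χ₃_mem.1.1.2.1.monotone
  have h4 := hB.χ₄_mem.1.1.2.1.monotone
  have hσ := hB.σ₂_mem.1.1.2.1.monotone
  have hst' : (s : ℝ≥0) ≤ t := by exact_mod_cast hst
  have hw := monotone_wBar hn σw hδ hst
  simp only [xBar]
  gcongr
  · exact h1 hst'
  · exact h3 (by gcongr)
  · exact h4 (mul_le_mul' hst' (hσ hw))

/-- The feedback controls, once realised, form an open-loop input sequence, so the deterministic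
growth bound applies pathwise. -/
theorem traj_fst_eq_φ (x0 : L.stateSpace) (w : ℕ → L.procSpace) (s : ℕ → L.explSpace) (t : ℕ) :
    (L.traj x0 w s t).1 = L.φ x0 (fun i => (L.traj x0 w s i).2) w t := by
  induction t with
  | zero => simp [traj, φ]
  | succ t ih => rw [traj_succ, φ, ← ih]

theorem exists_traj_snd_eq (x0 : L.stateSpace) (w : ℕ → L.procSpace) (s : ℕ → L.explSpace)
    (t : ℕ) : ∃ x e ϑ, (L.traj x0 w s t).2 = L.α (x, e, ϑ) := by
  cases t with
  | zero => exact ⟨x0, s 0, L.ϑ0, by simp [traj]⟩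
  | succ t => exact ⟨_, _, _, by rw [traj_succ]⟩

theorem nnnorm_traj_snd_le (hC : L.ControlBound B) (x0 : L.stateSpace) (w : ℕ → L.procSpace)
    (s : ℕ → L.explSpace) (t : ℕ) : ‖((L.traj x0 w s t).2 : Vec m)‖₊ ≤ B.umax := by
  obtain ⟨x, e, ϑ, h⟩ := L.exists_traj_snd_eq x0 w s t
  rw [h]
  exact hC x e ϑ

/-- The state bound holds along noise realisations that obey the noise bound. -/
theorem nnnorm_traj_fst_le (hn : 0 < n) (hB : L.StateBound B) (hC : L.ControlBound B) (σw : ℝ≥0)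
    {δ : ℝ} (hδ : 0 < δ) {x0 : L.stateSpace}
    (hx0 : ‖(x0 : Vec n)‖₊ ≤ B.χ₂ ‖(x0 : Vec n)‖₊ + B.c₁) {w : ℕ → L.procSpace}
    (s : ℕ → L.explSpace) (hw : ∀ t, 1 ≤ t → ‖(w t : Vec n)‖₊ ≤ wBar n σw t δ) (t : ℕ) :
    ‖((L.traj x0 w s t).1 : Vec n)‖₊ ≤ L.xBar B σw t δ x0 := by
  -- The growth bound starts at `t = 1`; at time 0 the condition on the initial state replaces it.
  rcases Nat.eq_zero_or_pos t with rfl | ht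
  · have h : (L.traj x0 w s 0).1 = x0 := by simp [traj]
    rw [h, xBar]
    refine hx0.trans ?_
    gcongr
    exact (le_add_of_nonneg_left zero_le).trans
      ((le_add_of_nonneg_right zero_le).trans (le_add_of_nonneg_right zero_le))
  rw [traj_fst_eq_φ, xBar]
  refine (hB.bound t ht _ _ _).trans ?_
  have h3 := hB.χ₃_mem.1.1.2.1.monotone
  have h4 := hB.χ₄_mem.1.1.2.1.monotone
  have hσ₁ := hB.σ₁_mem.1.2.1.monotone
  have hσ₂ := hB.σ₂_mem.1.1.2.1.monotone
  gcongr
  · refine h3 ((Finset.sum_le_sum fun i _ => hσ₁ (L.nnnorm_traj_snd_le B hC x0 w s i)).trans_eq ?_)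
    simp
  · refine h4 ((Finset.sum_le_sum fun i hi => hσ₂ ((hw i (Finset.mem_Icc.1 hi).1).trans
      (monotone_wBar hn σw hδ (Finset.mem_Icc.1 hi).2))).trans_eq ?_)
    simp

/-- The regressor bound. -/
theorem norm_ψ_traj_le (hC : L.ControlBound B) (hΨ : L.BasisBound B) (σw : ℝ≥0) {δ : ℝ}
    {x0 : L.stateSpace} (w : ℕ → L.procSpace) (s : ℕ → L.explSpace) {t : ℕ}
    (hx : ‖((L.traj x0 w s t).1 : Vec n)‖₊ ≤ L.xBar B σw t δ x0) :
    ‖L.ψ (L.traj x0 w s t)‖ ≤ L.zBar B σw (t + 1) δ x0 := by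
  rw [← coe_nnnorm, NNReal.coe_le_coe]
  refine (hΨ.bound (L.traj x0 w s t).1 (L.traj x0 w s t).2).trans (hΨ.mono ?_)
  have := L.nnnorm_traj_snd_le B hC x0 w s t
  rw [Nat.add_sub_cancel]
  exact NNReal.sqrt_le_sqrt.2 (by gcongr)

theorem sum_norm_ψ_traj_sq_le (hC : L.ControlBound B) (hΨ : L.BasisBound B) (σw : ℝ≥0) {δ : ℝ}
    {x0 : L.stateSpace} (w : ℕ → L.procSpace) (s : ℕ → L.explSpace) {t : ℕ}
    (hx : ∀ i < t, ‖((L.traj x0 w s i).1 : Vec n)‖₊ ≤ L.xBar B σw i δ x0) :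
    ∑ i ∈ Finset.range t, ‖L.ψ (L.traj x0 w s i)‖ ^ 2 ≤ L.zBarSum B σw t δ x0 := by
  have : L.zBarSum B σw t δ x0 =
      ∑ i ∈ Finset.range t, (L.zBar B σw (i + 1) δ x0 : ℝ) ^ 2 := by
    rw [zBarSum, Finset.range_eq_Ico, Finset.sum_Ico_add' (fun i => (L.zBar B σw i δ x0 : ℝ) ^ 2)]
    rfl
  rw [this]
  refine Finset.sum_le_sum fun i hi => ?_
  gcongr
  exact L.norm_ψ_traj_le B hC hΨ σw w s (hx i (Finset.mem_range.1 hi))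

theorem zBarSum_nonneg (σw : ℝ≥0) (t : ℕ) (δ : ℝ) (x0 : L.stateSpace) :
    0 ≤ L.zBarSum B σw t δ x0 := Finset.sum_nonneg fun _ _ => sq_nonneg _

/-- Up to the excited time, predictions from bounded states lie in the excited region. -/
theorem pred_mem_of_le_Texcited (hn : 0 < n) (hB : L.StateBound B) (hC : L.ControlBound B)
    {σw : ℝ≥0} {XPE : Set (Vec n)} {δ : ℝ} (hδ : 0 < δ) {x0 : L.stateSpace} {t : ℕ}
    (ht : (t : ℕ∞) ≤ L.Texcited B σw XPE δ x0) (w : ℕ → L.procSpace) (s : ℕ → L.explSpace)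
    {i : ℕ} (hi : i < t)
    (hx : ‖((L.traj x0 w s i).1 : Vec n)‖₊ ≤ L.xBar B σw i (δ / 3) x0) :
    L.pred (L.traj x0 w s i).1 (L.traj x0 w s i).2 ∈ XPE := by
  have hlt : (i : ℕ∞) < L.Texcited B σw XPE δ x0 := lt_of_lt_of_le (by exact_mod_cast hi) ht
  -- The supremum may be infinite, so some admissible `T > i` is taken instead; monotonicity of x̄
  -- in time makes its reachability condition cover time `i`.
  obtain ⟨_, ⟨T, rfl, -, hreach⟩, hiT⟩ := lt_sSup_iff.1 hlt
  have hiT' : i < T := by exact_mod_cast hiT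
  refine hreach ⟨_, _, ⟨?_, (L.traj x0 w s i).1.2⟩, L.nnnorm_traj_snd_le B hC x0 w s i, rfl⟩
  rw [mem_closedBall_zero_iff, ← coe_nnnorm, NNReal.coe_le_coe]
  exact hx.trans (L.monotone_xBar B hn hB σw (by positivity) x0 (by omega : i ≤ T - 1))

end ClosedLoop

end SysId

namespace SysId

/-! ### Excitation of the Gramian and the noise event. -/

namespace ClosedLoop

variable {n m d q : ℕ} (L : ClosedLoop n m d q) (B : Growth)

/-- The next state is the prediction plus fresh noise, so regional excitation at the predicted point
is a statement about the next regressor, with the current estimate frozen as ϑ. -/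
theorem excitation_prob_ge {μw : Measure L.procSpace} {μs : Measure L.explSpace}
    {XPE : Set (Vec n)} {c p : ℝ} (hexc : L.RegionallyExcited μw μs XPE c p)
    {x : L.stateSpace × L.controlSpace} (hx : L.pred x.1 x.2 ∈ XPE) (ϑ : Mat d n) {ζ : Vec d}
    (hζ : ‖ζ‖ = 1) :
    ENNReal.ofReal p ≤ (μw.prod μs) {y | c ≤ inner ℝ ζ (L.ψ (L.step (x, ϑ) y)) ^ 2} := by
  refine (ENNReal.ofReal_le_ofReal (hexc ϑ _ hx ζ hζ)).trans (ENNReal.ofReal_toReal_le.trans ?_)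
  refine measure_mono ?_
  rintro y ⟨_, hc⟩
  rw [sq_abs] at hc
  exact hc

section Random

variable {Ω : Type*} {mΩ : MeasurableSpace Ω} {P : Measure Ω} [IsProbabilityMeasure P]
  {W : ℕ → Ω → L.procSpace} {S : ℕ → Ω → L.explSpace}
  {μw : Measure L.procSpace} {μs : Measure L.explSpace} {σw : ℝ≥0}

/-- The event that the state bound holds up to time `t`. -/
def boundedStates (W : ℕ → Ω → L.procSpace) (S : ℕ → Ω → L.explSpace) (σw : ℝ≥0) (δ : ℝ)
    (x0 : L.stateSpace) (t : ℕ) : Set Ω :=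
  {ω | ∀ i ≤ t, ‖((L.traj x0 (fun i => W i ω) (fun i => S i ω) i).1 : Vec n)‖₊ ≤
    L.xBar B σw i δ x0}

theorem antitone_boundedStates (δ : ℝ) (x0 : L.stateSpace) :
    Antitone (L.boundedStates B W S σw δ x0) := fun _ _ h _ hω i hi => hω i (hi.trans h)

theorem measurableSet_boundedStates (hL : L.MeasurableMaps) (hW : ∀ t, Measurable (W (t + 1)))
    (hS : ∀ t, Measurable (S t)) (δ : ℝ) (x0 : L.stateSpace) (t : ℕ) :
    MeasurableSet[L.noiseFiltration hW hS t] (L.boundedStates B W S σw δ x0 t) := by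
  have : L.boundedStates B W S σw δ x0 t = ⋂ i, ⋂ (_ : i ≤ t),
      {ω | ‖((L.traj x0 (fun i => W i ω) (fun i => S i ω) i).1 : Vec n)‖₊ ≤
        L.xBar B σw i δ x0} := by
    ext; simp [boundedStates]
  rw [this]
  refine MeasurableSet.iInter fun i => MeasurableSet.iInter fun hi => ?_
  have h1 := (L.measurable_traj hL hW hS x0 i).mono ((L.noiseFiltration hW hS).mono hi) le_rfl
  have h2 : Measurable fun x : L.stateSpace × L.controlSpace => ‖(x.1 : Vec n)‖₊ := by fun_prop
  exact (h2.comp h1) measurableSet_Iic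

/-- Along every fixed direction, the regressors are sufficiently often excited. -/
theorem measure_count_lt_le (hn : 0 < n) (hL : L.MeasurableMaps)
    (hN : L.NoiseAssumption P W S μw μs σw) (hB : L.StateBound B) (hC : L.ControlBound B)
    {XPE : Set (Vec n)} {c p : ℝ} (hp : 0 < p) (hexc : L.RegionallyExcited μw μs XPE c p) {δ : ℝ}
    (hδ : 0 < δ) {x0 : L.stateSpace} {k : ℕ} (hk : ((k + 1 : ℕ) : ℕ∞) ≤ L.Texcited B σw XPE δ x0)
    {ζ : Vec d} (hζ : ‖ζ‖ = 1) :
    P (L.boundedStates B W S σw (δ / 3) x0 k ∩ {ω | ∑ i ∈ Finset.range k,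
      {ω | c ≤ inner ℝ ζ (L.ψ (L.traj x0 (fun i => W i ω) (fun i => S i ω) (i + 1))) ^ 2}.indicator
        (1 : Ω → ℝ) ω < p * k / 2}) ≤
      ENNReal.ofReal (Real.exp (-((1 - Real.log 2) * p * k / 2))) := by
  have hW : ∀ t, Measurable (W (t + 1)) := fun t => hN.measurable_W (t + 1) (by omega)
  have hS : ∀ t, Measurable (S t) := hN.measurable_S
  have hψm : Measurable fun x : L.stateSpace × L.controlSpace => inner ℝ ζ (L.ψ x) ^ 2 := by
    have := hL.2.1
    fun_prop
  refine measure_card_lt_le (L.noiseFiltration hW hS)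
    (E := fun i => {ω | c ≤ inner ℝ ζ (L.ψ (L.traj x0 (fun i => W i ω) (fun i => S i ω) i)) ^ 2})
    (fun i => (hψm.comp (L.measurable_traj hL hW hS x0 i)) measurableSet_Ici)
    (L.antitone_boundedStates B (δ / 3) x0)
    (L.measurableSet_boundedStates B hL hW hS (δ / 3) x0) hp.le fun i hi f hf => ?_
  set A := L.boundedStates B W S σw (δ / 3) x0 i
  have hA : MeasurableSet[L.noiseFiltration hW hS i] A :=
    L.measurableSet_boundedStates B hL hW hS (δ / 3) x0 i
  have hA' : MeasurableSet A := (L.noiseFiltration hW hS).le i _ hA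
  let D : Set (((L.stateSpace × L.controlSpace) × Mat d n) × (L.procSpace × L.explSpace)) :=
    {x | c ≤ inner ℝ ζ (L.ψ (L.step x.1 x.2)) ^ 2}
  have hD : MeasurableSet D := (hψm.comp (L.measurable_step hL)) measurableSet_Ici
  have hF : Measurable (D.indicator fun _ => (1 : ℝ≥0∞)) := measurable_const.indicator hD
  have hfA : Measurable[L.noiseFiltration hW hS i] (A.indicator f) := hf.indicator hA
  -- State, control and estimate at time `i` are frozen while the fresh pair (W(i+1), S(i+1)) is
  -- integrated under μw × μs.
  have hfreeze := lintegral_mul_comp_of_indep ((L.noiseFiltration hW hS).le i)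
    ((hW i).prodMk (hS (i + 1))) (L.indep_noiseFiltration hN hW hS i)
    ((L.measurable_traj hL hW hS x0 i).prodMk (L.measurable_estimate hL hW hS x0 i)) hfA hF
  rw [L.map_noise_pair hN] at hfreeze
  calc ENNReal.ofReal p * ∫⁻ ω in A, f ω ∂P
      = ∫⁻ ω, A.indicator f ω * ENNReal.ofReal p ∂P := by
        rw [lintegral_mul_const _ (hfA.mono ((L.noiseFiltration hW hS).le i) le_rfl),
          lintegral_indicator hA', mul_comm]
    _ ≤ _ := by
        refine lintegral_mono fun ω => ?_
        by_cases hω : ω ∈ A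
        · refine mul_le_mul_right ?_ _
          have hx := L.pred_mem_of_le_Texcited B hn hB hC hδ hk (fun i => W i ω)
            (fun i => S i ω) (show i < k + 1 by omega) (hω i le_rfl)
          refine (L.excitation_prob_ge hexc hx
            (L.estimate x0 (fun i => W i ω) (fun i => S i ω) i) hζ).trans_eq ?_
          rw [← lintegral_indicator_one]
          · rfl
          · exact measurable_prodMk_left hD
        · simp [hω]
    _ = _ := hfreeze.symm
    _ = _ := by
        rw [← lintegral_indicator hA']
        refine lintegral_congr fun ω => ?_
        have hiff : ((L.traj x0 (fun i => W i ω) (fun i => S i ω) i,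
            L.estimate x0 (fun i => W i ω) (fun i => S i ω) i), W (i + 1) ω, S (i + 1) ω) ∈ D ↔
            c ≤ inner ℝ ζ (L.ψ (L.traj x0 (fun i => W i ω) (fun i => S i ω) (i + 1))) ^ 2 := by
          rw [traj_succ]
          rfl
        by_cases hω : ω ∈ A
        · simp only [hω, indicator, hiff, mem_ofPred_eq]
          rfl
        · simp [hω]

/-- Along all directions simultaneously, the regressors are sufficiently excited. -/
theorem measure_exists_sum_lt_le (hn : 0 < n) (hd : 0 < d) (hL : L.MeasurableMaps)
    (hN : L.NoiseAssumption P W S μw μs σw) (hB : L.StateBound B) (hC : L.ControlBound B)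
    (hΨ : L.BasisBound B) {XPE : Set (Vec n)} {c p : ℝ} (hc : 0 < c) (hp : 0 < p)
    (hexc : L.RegionallyExcited μw μs XPE c p) {δ : ℝ} (hδ : 0 < δ) {x0 : L.stateSpace} {k : ℕ}
    (hk0 : 0 < k) (hk : ((k + 1 : ℕ) : ℕ∞) ≤ L.Texcited B σw XPE δ x0) :
    P (L.boundedStates B W S σw (δ / 3) x0 k ∩ {ω | ∃ u : Vec d, ‖u‖ = 1 ∧
      ∑ i ∈ Finset.range k,
        inner ℝ u (L.ψ (L.traj x0 (fun i => W i ω) (fun i => S i ω) (i + 1))) ^ 2 <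
          c * p / 4 * k}) ≤
      ENNReal.ofReal ((1 + 16 * L.zBarSum B σw (k + 1) (δ / 3) x0 / (c * p * k)) ^ d *
        Real.exp (-((1 - Real.log 2) * p * k / 2))) := by
  have hk' : (0 : ℝ) < k := by exact_mod_cast hk0
  have hZ := L.zBarSum_nonneg B σw (k + 1) (δ / 3) x0
  -- On the net the sum is at least c · p k / 2; passing to a nearby direction loses 2κ = c p k / 4,
  -- which leaves c p k / 4. The cardinality 1 + 2S/κ becomes 1 + 16 S / (c p k), to the power d.
  obtain ⟨N, hN1, hnet, hcard⟩ := exists_sphere_net_mul_le hd hZ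
    (show 0 < c * p * k / 8 by positivity)
  have hcard' : (N.card : ℝ) ≤
      (1 + 16 * L.zBarSum B σw (k + 1) (δ / 3) x0 / (c * p * k)) ^ d := by
    refine hcard.trans_eq ?_
    congr 2
    field_simp
    ring
  have hincl : (L.boundedStates B W S σw (δ / 3) x0 k ∩ {ω | ∃ u : Vec d, ‖u‖ = 1 ∧
      ∑ i ∈ Finset.range k,
        inner ℝ u (L.ψ (L.traj x0 (fun i => W i ω) (fun i => S i ω) (i + 1))) ^ 2 <
          c * p / 4 * k}) ⊆
      ⋃ ζ ∈ N, (L.boundedStates B W S σw (δ / 3) x0 k ∩ {ω | ∑ i ∈ Finset.range k,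
        {ω | c ≤ inner ℝ ζ (L.ψ (L.traj x0 (fun i => W i ω) (fun i => S i ω) (i + 1))) ^ 2}.indicator
          (1 : Ω → ℝ) ω < p * k / 2}) := by
    rintro ω ⟨hω, u, hu, hlt⟩
    obtain ⟨x, hx, hux⟩ := hnet u hu
    simp only [mem_iUnion]
    refine ⟨x, hx, hω, ?_⟩
    by_contra hge
    rw [mem_ofPred_eq, not_lt] at hge
    have hsq := L.sum_norm_ψ_traj_sq_le B hC hΨ σw (fun i => W i ω) (fun i => S i ω)
      (t := k + 1) (fun i hi => hω i (by omega))
    -- The regressor at time 0 is not preceded by noise and is not counted; hence t - 1 in the error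
    -- bound.
    rw [Finset.sum_range_succ'] at hsq
    have hsq' : ∑ i ∈ Finset.range k, ‖L.ψ (L.traj x0 (fun i => W i ω) (fun i => S i ω) (i + 1))‖ ^ 2
        ≤ L.zBarSum B σw (k + 1) (δ / 3) x0 := (le_add_of_nonneg_right (sq_nonneg _)).trans hsq
    have hlow : c * (p * k / 2) ≤ ∑ i ∈ Finset.range k,
        inner ℝ x (L.ψ (L.traj x0 (fun i => W i ω) (fun i => S i ω) (i + 1))) ^ 2 := by
      refine (mul_le_mul_of_nonneg_left hge hc.le).trans ?_
      rw [Finset.mul_sum]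
      refine Finset.sum_le_sum fun i _ => ?_
      by_cases h : c ≤ inner ℝ x (L.ψ (L.traj x0 (fun i => W i ω) (fun i => S i ω) (i + 1))) ^ 2
      · simp [h]
      · simp [h, sq_nonneg]
    have := sum_inner_sq_ge_of_near _ _ hsq' hu (hN1 x hx) hux hlow
    linarith
  refine (measure_mono hincl).trans ((measure_biUnion_finset_le _ _).trans ?_)
  refine (Finset.sum_le_sum fun ζ hζ =>
    L.measure_count_lt_le B hn hL hN hB hC hp hexc hδ hk (hN1 ζ hζ)).trans ?_
  rw [Finset.sum_const, nsmul_eq_mul, ← ENNReal.ofReal_natCast,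
    ← ENNReal.ofReal_mul (Nat.cast_nonneg _)]
  exact ENNReal.ofReal_le_ofReal (mul_le_mul_of_nonneg_right hcard' (Real.exp_pos _).le)

/-- The burn-in time, if finite, is admissible. -/
theorem Tburnin_spec {c p δ : ℝ} {x0 : L.stateSpace} {T : ℕ} (hT : L.Tburnin B σw c p δ x0 = T) :
    1 ≤ T ∧ ∀ t : ℕ, T ≤ t →
      2 / ((1 - Real.log 2) * p) *
        (d * Real.log (1 + 16 * L.zBarSum B σw t (δ / 3) x0 / (c * p * ((t : ℝ) - 1)))
          + Real.log (Real.pi ^ 2 * ((t : ℝ) - T + 1) ^ 2 / (2 * δ))) + 1 ≤ (t : ℝ) := by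
  rw [Tburnin] at hT
  rcases eq_empty_or_nonempty {τ : ℕ∞ | ∃ T : ℕ, τ = T ∧ 1 ≤ T ∧ ∀ t : ℕ, T ≤ t →
    2 / ((1 - Real.log 2) * p) *
        (d * Real.log (1 + 16 * L.zBarSum B σw t (δ / 3) x0 / (c * p * ((t : ℝ) - 1)))
          + Real.log (Real.pi ^ 2 * ((t : ℝ) - T + 1) ^ 2 / (2 * δ))) + 1 ≤ (t : ℝ)} with h | h
  · rw [h, sInf_empty] at hT
    exact absurd hT (ENat.top_ne_natCast T)
  · have hmem := csInf_mem h
    rw [hT] at hmem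
    obtain ⟨T', hTT', hspec⟩ := hmem
    obtain rfl : T = T' := by exact_mod_cast hTT'
    exact hspec

/-- At t = T = 1 the division by t - 1 = 0 makes the dimension term vanish, but log (π² / (2δ)) is
still positive and violates the inequality. -/
theorem two_le_of_Tburnin_eq {c p δ : ℝ} (hp : 0 < p) (hδ : 0 < δ) (hδ1 : δ < 1)
    {x0 : L.stateSpace} {T : ℕ} (hT : L.Tburnin B σw c p δ x0 = T) : 2 ≤ T := by
  obtain ⟨h1, h⟩ := L.Tburnin_spec B hT
  by_contra hlt
  obtain rfl : T = 1 := by omega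
  have h := h 1 le_rfl
  have hlog2 : Real.log 2 < 1 := by linarith [Real.log_two_lt_d9]
  have hpi := Real.pi_gt_three
  have hpos : 0 < Real.log (Real.pi ^ 2 / (2 * δ)) := by
    refine Real.log_pos ?_
    rw [lt_div_iff₀ (by positivity)]
    nlinarith
  simp only [Nat.cast_one, sub_self, mul_zero, div_zero, add_zero, Real.log_one, zero_add,
    one_pow, mul_one] at h
  have : 0 < 2 / ((1 - Real.log 2) * p) * Real.log (Real.pi ^ 2 / (2 * δ)) := by
    have : 0 < 1 - Real.log 2 := by linarith
    positivity
  linarith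

/-- Between the burn-in time and the excited time, the Gramian is well conditioned with high
probability. -/
theorem measure_exists_not_excited_le (hn : 0 < n) (hd : 0 < d) (hL : L.MeasurableMaps)
    (hN : L.NoiseAssumption P W S μw μs σw) (hB : L.StateBound B) (hC : L.ControlBound B)
    (hΨ : L.BasisBound B) {XPE : Set (Vec n)} {c p : ℝ} (hc : 0 < c) (hp : 0 < p)
    (hexc : L.RegionallyExcited μw μs XPE c p) {δ : ℝ} (hδ : 0 < δ) (hδ1 : δ < 1)
    {x0 : L.stateSpace} :
    P {ω | ∃ k : ℕ, L.Tburnin B σw c p δ x0 ≤ ((k + 1 : ℕ) : ℕ∞) ∧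
      ((k + 1 : ℕ) : ℕ∞) ≤ L.Texcited B σw XPE δ x0 ∧
      ω ∈ L.boundedStates B W S σw (δ / 3) x0 k ∩ {ω | ∃ u : Vec d, ‖u‖ = 1 ∧
        ∑ i ∈ Finset.range k,
          inner ℝ u (L.ψ (L.traj x0 (fun i => W i ω) (fun i => S i ω) (i + 1))) ^ 2 <
            c * p / 4 * k}} ≤ ENNReal.ofReal (δ / 3) := by
  rcases eq_or_ne (L.Tburnin B σw c p δ x0) ⊤ with htop | htop
  · simp [htop]
  obtain ⟨T, hT⟩ := ENat.ne_top_iff_exists.1 htop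
  have hT2 := L.two_le_of_Tburnin_eq B hp hδ hδ1 hT.symm
  obtain ⟨-, hspec⟩ := L.Tburnin_spec B hT.symm
  set bad : ℕ → Set Ω := fun k => L.boundedStates B W S σw (δ / 3) x0 k ∩
    {ω | ∃ u : Vec d, ‖u‖ = 1 ∧ ∑ i ∈ Finset.range k,
      inner ℝ u (L.ψ (L.traj x0 (fun i => W i ω) (fun i => S i ω) (i + 1))) ^ 2 <
        c * p / 4 * k} with hbad
  -- Reindexed by j = t - T + 1 with t = k + 1, the argument of the Basel weights; `2 ≤ T` keeps the
  -- subtraction from truncating.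
  let s : ℕ → Set Ω := fun j => {ω | 1 ≤ j ∧
    ((T - 2 + j + 1 : ℕ) : ℕ∞) ≤ L.Texcited B σw XPE δ x0 ∧ ω ∈ bad (T - 2 + j)}
  have hincl : {ω | ∃ k : ℕ, L.Tburnin B σw c p δ x0 ≤ ((k + 1 : ℕ) : ℕ∞) ∧
      ((k + 1 : ℕ) : ℕ∞) ≤ L.Texcited B σw XPE δ x0 ∧ ω ∈ bad k} ⊆ ⋃ j, s j := by
    rintro ω ⟨k, h1, h2, h3⟩
    rw [← hT] at h1
    have h1' : T ≤ k + 1 := by exact_mod_cast h1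
    have hk : T - 2 + (k + 2 - T) = k := by omega
    rw [mem_iUnion]
    refine ⟨k + 2 - T, by omega, ?_, ?_⟩
    · rw [hk]; exact h2
    · rw [hk]; exact h3
  refine (measure_mono hincl).trans (measure_iUnion_le_of_le_sq (by positivity) fun j => ?_)
  by_cases hj : 1 ≤ j ∧ ((T - 2 + j + 1 : ℕ) : ℕ∞) ≤ L.Texcited B σw XPE δ x0
  swap
  · have : s j = ∅ := by
      ext ω
      simp only [s, mem_ofPred_eq, mem_empty_iff_false, iff_false]
      exact fun h => hj ⟨h.1, h.2.1⟩
    simp [this]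
  obtain ⟨hj1, hj2⟩ := hj
  have hle := L.measure_exists_sum_lt_le B hn hd hL hN hB hC hΨ hc hp hexc hδ
    (show 0 < T - 2 + j by omega) hj2
  refine (measure_mono (fun ω hω => hω.2.2)).trans (hle.trans (ENNReal.ofReal_le_ofReal ?_))
  have hburn := hspec (T - 2 + j + 1) (by omega)
  set k := T - 2 + j with hk
  have hk0 : (0 : ℝ) < k := by
    have : 0 < k := by omega
    exact_mod_cast this
  have hj0 : (0 : ℝ) < j := by exact_mod_cast hj1
  have hkj : ((k + 1 : ℕ) : ℝ) - T + 1 = j := by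
    have : k + 2 = T + j := by omega
    have : (k : ℝ) + 2 = T + j := by exact_mod_cast this
    push_cast
    linarith
  have hk1 : ((k + 1 : ℕ) : ℝ) - 1 = k := by push_cast; ring
  rw [hkj, hk1] at hburn
  have hlog2 : 0 < 1 - Real.log 2 := by linarith [Real.log_two_lt_d9]
  have hZ := L.zBarSum_nonneg B σw (k + 1) (δ / 3) x0
  set X := 1 + 16 * L.zBarSum B σw (k + 1) (δ / 3) x0 / (c * p * k) with hX
  have hX0 : 0 < X := by positivity
  have hpi := Real.pi_pos
  set M := Real.log (Real.pi ^ 2 * (j : ℝ) ^ 2 / (2 * δ)) with hM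
  -- The burn-in inequality at t = k + 1, solved for the Chernoff exponent: it pays for the net (d
  -- log X) and for the weight of index `j` (M).
  have h1 : d * Real.log X + M ≤ (1 - Real.log 2) * p * k / 2 := by
    have h2 : 2 / ((1 - Real.log 2) * p) * (d * Real.log X + M) ≤ k := by
      push_cast at hburn
      linarith
    rw [div_mul_eq_mul_div, div_le_iff₀ (by positivity)] at h2
    linarith
  calc X ^ d * Real.exp (-((1 - Real.log 2) * p * k / 2))
      = Real.exp (d * Real.log X + -((1 - Real.log 2) * p * k / 2)) := by
        rw [Real.exp_add, Real.exp_nat_mul, Real.exp_log hX0]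
    _ ≤ Real.exp (-M) := Real.exp_le_exp.2 (by linarith)
    _ = δ / 3 * (6 / Real.pi ^ 2 * (1 / (j : ℝ) ^ 2)) := by
        rw [Real.exp_neg, hM, Real.exp_log (by positivity)]
        field_simp
        norm_num

/-- The self-normalized noise terms are bounded with high probability. -/
theorem measure_exists_lt_noise_quad_le (hn : 0 < n) (hL : L.MeasurableMaps)
    (hN : L.NoiseAssumption P W S μw μs σw) {ε : ℝ} (hε : 0 < ε) {x0 : L.stateSpace} :
    P {ω | ∃ (j : Fin n) (t : ℕ),
      2 * (σw ^ 2 : ℝ≥0) * Real.log (√((gram L.γ (fun s => (L.ψ (L.traj x0 (fun i => W i ω)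
        (fun i => S i ω) s)).ofLp) t).det / L.γ ^ d) / (ε / n)) <
      cross (fun s => (L.ψ (L.traj x0 (fun i => W i ω) (fun i => S i ω) s)).ofLp)
        (fun s => (W s ω : Vec n).ofLp j) t ⬝ᵥ
      (gram L.γ (fun s => (L.ψ (L.traj x0 (fun i => W i ω) (fun i => S i ω) s)).ofLp) t)⁻¹.mulVec
        (cross (fun s => (L.ψ (L.traj x0 (fun i => W i ω) (fun i => S i ω) s)).ofLp)
          (fun s => (W s ω : Vec n).ofLp j) t)} ≤ ENNReal.ofReal ε := by
  have hn' : (0 : ℝ) < n := by exact_mod_cast hn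
  have hW : ∀ t, Measurable (W (t + 1)) := fun t => hN.measurable_W (t + 1) (by omega)
  have hS : ∀ t, Measurable (S t) := hN.measurable_S
  have hcoord : ∀ j : Fin n, Measurable fun w : L.procSpace => (w : Vec n).ofLp j := fun j => by
    fun_prop
  have hψm : Measurable fun x => (L.ψ x).ofLp := by
    have := hL.2.1
    fun_prop
  rw [Set.ofPred_exists]
  refine (measure_iUnion_le _).trans ?_
  rw [tsum_fintype]
  -- Each noise coordinate is a scalar sub-Gaussian sequence and gets the share ε / n.
  have hj : ∀ j : Fin n, _ := fun j => measure_exists_lt_quad_le (P := P)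
    (L.noiseFiltration hW hS)
    (z := fun s ω => (L.ψ (L.traj x0 (fun i => W i ω) (fun i => S i ω) s)).ofLp)
    (w := fun s ω => (W s ω : Vec n).ofLp j) (c := σw ^ 2)
    (fun t => hψm.comp (L.measurable_traj hL hW hS x0 t))
    (fun t => (hcoord j).comp (L.measurable_noiseFiltration_W hW hS t))
    (fun t => indep_of_indep_of_le_right (L.indep_noiseFiltration hN hW hS t)
      (measurable_iff_comap_le.1 (((hcoord j).comp measurable_fst).comp (comap_measurable _))))
    (fun t => by
      have := hN.subGaussian_W (t + 1) (by omega) (EuclideanSpace.single j (1 : ℝ)) (by simp)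
      simpa [EuclideanSpace.inner_single_left] using this)
    L.γ_pos (show 0 < ε / n by positivity)
  refine (Finset.sum_le_sum fun j _ => hj j).trans_eq ?_
  rw [Finset.sum_const, Finset.card_univ, Fintype.card_fin, nsmul_eq_mul,
    ← ENNReal.ofReal_natCast, ← ENNReal.ofReal_mul hn'.le]
  congr 1
  field_simp

end Random

/-! ### The error bound along a single realisation. -/

/-- The error equation of the estimate. -/
theorem gram_mul_estimate_sub {t : ℕ} (ht : 1 ≤ t) (x0 : L.stateSpace) (w : ℕ → L.procSpace)
    (s : ℕ → L.explSpace) :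
    gram L.γ (fun i => (L.ψ (L.traj x0 w s i)).ofLp) t * (L.estimate x0 w s t - L.θs) =
      ∑ i ∈ Finset.range t, Matrix.vecMulVec (L.ψ (L.traj x0 w s i)).ofLp
        (w (i + 1) : Vec n).ofLp - L.γ • L.θs := by
  have h := L.gram_mul_rls (by omega : t ≠ 0) fun i => L.traj x0 w s i.1
  simp only [Fin.val_castSucc, Fin.val_succ] at h
  rw [Fin.sum_univ_eq_sum_range fun i => Matrix.vecMulVec (L.ψ (L.traj x0 w s i)).ofLp
    (L.ψ (L.traj x0 w s i)).ofLp, Fin.sum_univ_eq_sum_range fun i =>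
      Matrix.vecMulVec (L.ψ (L.traj x0 w s i)).ofLp
        (((L.traj x0 w s (i + 1)).1 : Vec n) - L.f (L.traj x0 w s i)).ofLp] at h
  have hr : ∀ i, Matrix.vecMulVec (L.ψ (L.traj x0 w s i)).ofLp
      (((L.traj x0 w s (i + 1)).1 : Vec n) - L.f (L.traj x0 w s i)).ofLp =
      Matrix.vecMulVec (L.ψ (L.traj x0 w s i)).ofLp (L.ψ (L.traj x0 w s i)).ofLp * L.θs +
        Matrix.vecMulVec (L.ψ (L.traj x0 w s i)).ofLp (w (i + 1) : Vec n).ofLp := by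
    intro i
    have e : ((L.traj x0 w s (i + 1)).1 : Vec n) - L.f (L.traj x0 w s i) =
        tmul L.θs (L.ψ (L.traj x0 w s i)) + (w (i + 1) : Vec n) := by
      rw [traj_succ, g]
      simp only [Prod.mk.eta]
      abel
    rw [e]
    ext a b
    simp only [Matrix.vecMulVec_apply, Matrix.add_apply, Matrix.mul_apply, PiLp.add_apply,
      tmul_apply, mul_add, Finset.mul_sum]
    congr 1
    exact Finset.sum_congr rfl fun k _ => by ring
  simp only [hr, Finset.sum_add_distrib, ← Matrix.sum_mul] at h
  rw [Matrix.mul_sub]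
  change gram _ _ _ * L.estimate x0 w s t = _ at h
  rw [h, gram, Matrix.add_mul, Matrix.smul_mul, Matrix.one_mul]
  abel

/-- The error bound, given a lower bound on the Gramian. -/
theorem opNorm_estimate_sub_le (hn : 0 < n) (hC : L.ControlBound B) (hΨ : L.BasisBound B)
    (σw : ℝ≥0) {δ : ℝ} (hδ : 0 < δ) {x0 : L.stateSpace} {w : ℕ → L.procSpace}
    {s : ℕ → L.explSpace} {t : ℕ} (ht : 1 ≤ t)
    (hx : ∀ i < t, ‖((L.traj x0 w s i).1 : Vec n)‖₊ ≤ L.xBar B σw i (δ / 3) x0)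
    (hquad : ∀ j : Fin n, cross (fun i => (L.ψ (L.traj x0 w s i)).ofLp)
        (fun i => (w i : Vec n).ofLp j) t ⬝ᵥ
      (gram L.γ (fun i => (L.ψ (L.traj x0 w s i)).ofLp) t)⁻¹.mulVec
        (cross (fun i => (L.ψ (L.traj x0 w s i)).ofLp) (fun i => (w i : Vec n).ofLp j) t) ≤
      2 * (σw ^ 2 : ℝ≥0) * Real.log (√((gram L.γ (fun i =>
        (L.ψ (L.traj x0 w s i)).ofLp) t).det / L.γ ^ d) / (δ / 3 / n)))
    {lam : ℝ} (hlam : 0 < lam)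
    (hG : ∀ u : Vec d, ‖u‖ = 1 → lam - L.γ ≤
      ∑ i ∈ Finset.range t, inner ℝ u (L.ψ (L.traj x0 w s i)) ^ 2) :
    opNorm (L.estimate x0 w s t - L.θs) ≤ L.errBound B σw lam t δ x0 := by
  have hn' : (0 : ℝ) < n := by exact_mod_cast hn
  have hγ := L.γ_pos
  set z : ℕ → Fin d → ℝ := fun i => (L.ψ (L.traj x0 w s i)).ofLp with hz
  -- Extension from unit vectors by homogeneity; the regulariser supplies the γ subtracted in `hG`.
  have hG' : ∀ u : Fin d → ℝ, lam * (u ⬝ᵥ u) ≤ u ⬝ᵥ (gram L.γ z t).mulVec u := by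
    intro u
    rw [dotProduct_gram_mulVec]
    rcases eq_or_ne u 0 with rfl | hu
    · simp
    set v : Vec d := WithLp.toLp 2 u with hv
    have hv0 : v ≠ 0 := by
      intro h0
      apply hu
      have := congrArg WithLp.ofLp h0
      simpa [hv] using this
    have hnv : 0 < ‖v‖ := norm_pos_iff.2 hv0
    have h1 := hG (‖v‖⁻¹ • v) (by rw [norm_smul, norm_inv, norm_norm, inv_mul_cancel₀ hnv.ne'])
    have h2 : u ⬝ᵥ u = ‖v‖ ^ 2 := dotProduct_self_eq_norm_sq v
    have h3 : ∀ i, inner ℝ (‖v‖⁻¹ • v) (L.ψ (L.traj x0 w s i)) ^ 2 =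
        (‖v‖ ^ 2)⁻¹ * (u ⬝ᵥ z i) ^ 2 := by
      intro i
      rw [inner_smul_left, inner_eq_ofLp_dotProduct, mul_pow]
      simp [hv, hz]
    simp only [h3, ← Finset.mul_sum] at h1
    rw [inv_mul_eq_div, le_div_iff₀ (by positivity)] at h1
    rw [h2]
    linarith
  have hdet := (posDef_gram hγ z t).det_pos
  have hβ : ∑ i ∈ Finset.range t, z i ⬝ᵥ z i + L.γ ≤ L.βmax B σw t (δ / 3) x0 := by
    rw [βmax]
    have := L.sum_norm_ψ_traj_sq_le B hC hΨ σw w s hx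
    simp only [hz, dotProduct_self_eq_norm_sq]
    linarith
  have hβ0 : 0 < L.βmax B σw t (δ / 3) x0 := by
    have := L.zBarSum_nonneg B σw t (δ / 3) x0
    rw [βmax]
    linarith
  have hdetle := det_gram_le hγ z t hβ
  have h := opNorm_le_of_gram_mul_eq hγ z (fun i => (w i : Vec n).ofLp) t
    (L.gram_mul_estimate_sub ht x0 w s) hlam hG' hquad
  refine h.trans ?_
  rw [errBound]
  refine mul_le_mul_of_nonneg_left (add_le_add le_rfl ?_) (by positivity)
  -- The square root of det G / γ^d ≤ (β_max / γ)^d gives the term with d/2, and the share δ / 3 / n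
  -- of each coordinate gives log (3n / δ).
  have hlog : Real.log (√((gram L.γ z t).det / L.γ ^ d) / (δ / 3 / n)) ≤
      Real.log (3 * n / δ) + (d : ℝ) / 2 * Real.log (L.βmax B σw t (δ / 3) x0 * L.γ⁻¹) := by
    have e : √((gram L.γ z t).det / L.γ ^ d) / (δ / 3 / n) =
        3 * n / δ * √((gram L.γ z t).det / L.γ ^ d) := by
      field_simp
    rw [e, Real.log_mul (by positivity) (by positivity), Real.log_sqrt (by positivity)]
    have h1 : Real.log ((gram L.γ z t).det / L.γ ^ d) ≤
        d * Real.log (L.βmax B σw t (δ / 3) x0 * L.γ⁻¹) := by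
      rw [← Real.log_pow, mul_pow, inv_pow, ← div_eq_mul_inv]
      exact Real.log_le_log (by positivity) (by gcongr)
    linarith
  rw [← Real.sqrt_sq σw.coe_nonneg, ← Real.sqrt_mul (sq_nonneg _)]
  refine Real.sqrt_le_sqrt ?_
  rw [NNReal.coe_pow]
  calc (n : ℝ) * (2 * (σw : ℝ) ^ 2 * Real.log (√((gram L.γ z t).det / L.γ ^ d) / (δ / 3 / n)))
      ≤ n * (2 * (σw : ℝ) ^ 2 * (Real.log (3 * n / δ) +
          (d : ℝ) / 2 * Real.log (L.βmax B σw t (δ / 3) x0 * L.γ⁻¹))) := by gcongr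
    _ = _ := by ring

end ClosedLoop

end SysId

end

/-! ### Combination of the three events. -/

theorem proposition1 {n m d q : ℕ} (hn : 0 < n) (hd : 0 < d)
    {Ω : Type*} [MeasurableSpace Ω] (P : Measure Ω) [IsProbabilityMeasure P]
    (L : SysId.ClosedLoop n m d q)
    (W : ℕ → Ω → L.procSpace) (S : ℕ → Ω → L.explSpace)
    (μw : Measure L.procSpace) (μs : Measure L.explSpace) (σw : ℝ≥0)
    (B : SysId.Growth) (XPE : Set (SysId.Vec n)) (c p : ℝ)
    (hmeas : L.MeasurableMaps)
    (hnoise : L.NoiseAssumption P W S μw μs σw)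
    (hstate : L.StateBound B)
    (hcontrol : L.ControlBound B)
    (hbasis : L.BasisBound B)
    (hXPE : XPE ⊆ L.stateSpace) (hc : 0 < c) (hp : 0 < p)
    (hexc : L.RegionallyExcited μw μs XPE c p)
    (δ : ℝ) (hδ : δ ∈ Ioo (0 : ℝ) 1) (x0 : L.stateSpace)
    (hx0 : ‖(x0 : SysId.Vec n)‖₊ ≤ B.χ₂ ‖(x0 : SysId.Vec n)‖₊ + B.c₁)
    (hT : L.Tburnin B σw c p δ x0 ≤ L.Texcited B σw XPE δ x0) :
    1 - δ ≤ P.real {ω | ∀ t : ℕ, 1 ≤ t →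
      SysId.opNorm (L.estimate x0 (fun i => W i ω) (fun i => S i ω) t - L.θs)
        ≤ L.errExt B σw XPE c p t δ x0} := by
  obtain ⟨hδ0, hδ1⟩ := hδ
  have hγ := L.γ_pos
  set noiseBad := {ω | ∃ t, 1 ≤ t ∧ SysId.ClosedLoop.wBar n σw t (δ / 3) <
    ‖(W t ω : SysId.Vec n)‖₊}
  have h1 : P noiseBad ≤ ENNReal.ofReal (δ / 3) :=
    L.measure_exists_wBar_lt_le hn hnoise (by positivity) (by linarith)
  have h2 := L.measure_exists_not_excited_le B hn hd hmeas hnoise hstate hcontrol hbasis hc hp hexc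
    hδ0 hδ1 (x0 := x0)
  have h3 := L.measure_exists_lt_noise_quad_le hn hmeas hnoise (show 0 < δ / 3 by positivity)
    (x0 := x0)
  set A := {ω | ∀ t : ℕ, 1 ≤ t →
      SysId.opNorm (L.estimate x0 (fun i => W i ω) (fun i => S i ω) t - L.θs)
        ≤ L.errExt B σw XPE c p t δ x0}
  have hbad := (measure_union_le _ _).trans
    (add_le_add ((measure_union_le _ _).trans (add_le_add h1 h2)) h3)
  rw [← ENNReal.ofReal_add (by positivity) (by positivity),
    ← ENNReal.ofReal_add (by positivity) (by positivity),
    show δ / 3 + δ / 3 + δ / 3 = δ by ring] at hbad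
  -- `N` is the union of the three bad events. Covering the whole space by `A ∪ N` needs only
  -- subadditivity, so measurability of `A` plays no role.
  obtain ⟨N, hN, hcover⟩ : ∃ N, P N ≤ ENNReal.ofReal δ ∧ univ ⊆ A ∪ N := by
    refine ⟨_, hbad, ?_⟩
    intro ω _
    by_contra hω
    simp only [mem_union, not_or] at hω
    obtain ⟨hωA, ⟨hω1, hω2⟩, hω3⟩ := hω
    refine hωA fun t ht => ?_
    have hx : ∀ i, ‖((L.traj x0 (fun i => W i ω) (fun i => S i ω) i).1 : SysId.Vec n)‖₊ ≤
        L.xBar B σw i (δ / 3) x0 :=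
      L.nnnorm_traj_fst_le B hn hstate hcontrol σw (by positivity) hx0 _ fun i hi => by
        by_contra hlt
        exact hω1 ⟨i, hi, not_le.1 hlt⟩
    have herr := fun lam (hlam : 0 < lam) => L.opNorm_estimate_sub_le B hn hcontrol hbasis σw hδ0
      ht (w := fun i => W i ω) (s := fun i => S i ω) (fun i _ => hx i)
      (fun j => by
        by_contra hlt
        exact hω3 ⟨j, t, not_le.1 hlt⟩) hlam
    -- Excitation reached at time k + 1 persists at every later `t`, because the summands are
    -- nonnegative.
    have hexcited : ∀ k : ℕ, L.Tburnin B σw c p δ x0 ≤ ((k + 1 : ℕ) : ℕ∞) →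
        ((k + 1 : ℕ) : ℕ∞) ≤ L.Texcited B σw XPE δ x0 → k + 1 ≤ t →
        ∀ u : SysId.Vec d, ‖u‖ = 1 → c * p / 4 * k ≤ ∑ i ∈ Finset.range t,
          inner ℝ u (L.ψ (L.traj x0 (fun i => W i ω) (fun i => S i ω) i)) ^ 2 := by
      intro k hk1 hk2 hkt u hu
      by_contra hlt
      refine hω2 ⟨k, hk1, hk2, fun i _ => hx i, u, hu, lt_of_le_of_lt ?_ (not_le.1 hlt)⟩
      refine le_trans (le_add_of_nonneg_right (sq_nonneg (inner ℝ u
        (L.ψ (L.traj x0 (fun i => W i ω) (fun i => S i ω) 0))))) ?_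
      rw [← Finset.sum_range_succ' (fun i =>
        inner ℝ u (L.ψ (L.traj x0 (fun i => W i ω) (fun i => S i ω) i)) ^ 2)]
      exact Finset.sum_le_sum_of_subset_of_nonneg (Finset.range_subset_range.2 hkt)
        fun i _ _ => sq_nonneg _
    rw [SysId.ClosedLoop.errExt]
    split_ifs with hcase1 hcase2
    · refine herr L.γ hγ fun u _ => ?_
      rw [sub_self]
      exact Finset.sum_nonneg fun i _ => sq_nonneg _
    · obtain ⟨k, rfl⟩ : ∃ k, t = k + 1 := ⟨t - 1, by omega⟩
      have hk : ((k + 1 : ℕ) : ℝ) - 1 = k := by push_cast; ring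
      rw [SysId.ClosedLoop.err, hk]
      refine herr _ (by positivity) fun u hu => ?_
      rw [add_sub_cancel_right]
      exact hexcited k (not_lt.1 hcase1) hcase2 le_rfl u hu
    -- Past the excited time, that time is finite, and by `hT` it is not before the burn-in time;
    -- the lower bound obtained there is carried forward to `t`.
    · have hTlt := not_le.1 hcase2
      obtain ⟨T, hTe⟩ := ENat.ne_top_iff_exists.1 (ne_top_of_lt hTlt)
      rw [← hTe] at hTlt hT hexcited ⊢
      have hTt : T < t := by exact_mod_cast hTlt
      have hT1 : 1 ≤ T := by
        obtain ⟨T', hT'⟩ := ENat.ne_top_iff_exists.1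
          (ne_top_of_le_ne_top (ENat.natCast_ne_top T) hT)
        have h1 := (L.Tburnin_spec B hT'.symm).1
        rw [← hT'] at hT
        have : T' ≤ T := by exact_mod_cast hT
        omega
      obtain ⟨k, rfl⟩ : ∃ k, T = k + 1 := ⟨T - 1, by omega⟩
      have hk : (((k + 1 : ℕ) : ℕ∞).toNat : ℝ) - 1 = k := by
        rw [ENat.toNat_natCast]
        push_cast
        ring
      rw [hk]
      refine herr _ (by positivity) fun u hu => ?_
      rw [add_sub_cancel_right]
      exact hexcited k hT le_rfl hTt.le u hu
  have hone : 1 ≤ P A + ENNReal.ofReal δ := by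
    rw [← measure_univ (μ := P)]
    exact (measure_mono hcover).trans ((measure_union_le _ _).trans (add_le_add le_rfl hN))
  have hreal := ENNReal.toReal_mono (by finiteness) hone
  rw [ENNReal.toReal_add (by finiteness) (by finiteness), ENNReal.toReal_ofReal hδ0.le,
    ENNReal.toReal_one] at hreal
  rw [Measure.real]
  linarith
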